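/- Let $k$ be an algebraically closed field of arbitrary characteristic, let $X$ be a closed subscheme of $\mathbb{A}^N=\mathbb{A}^N_k$, and let $f_1,\ldots,f_m$ be generators of its ideal $I_X\subset k[x_1,\ldots,x_N]$. For $n\ge 0$ let $\mathcal{L}_n(X)$ be the set of $n$-jets on $X$, that is, of the tuples $\theta\in (k[[t]]/(t^{n+1}))^N$ with $p(\theta)=0$ for all $p\in I_X$; the coefficients of the components identify $\mathcal{L}_n(\mathbb{A}^N)$ with $k^{N(n+1)}$, which carries the Zariski topology. For $l\le n$ let $\pi^n_l:\mathcal{L}_n(\mathbb{A}^N)\to\mathcal{L}_l(\mathbb{A}^N)$ be the truncation map. For $\theta\in\mathcal{L}_n(X)$ let $e_1(\theta)\le\cdots\le e_N(\theta)\le n+1$ be the unique non-decreasing sequence of natural numbers such that the quotient of the $k[[t]]$-module $(k[[t]]/(t^{n+1}))^N$ by the submodule generated by the rows of the Jacobian matrix $\left(\frac{\partial f_i}{\partial x_j}(\theta)\right)_{1\le i\le m,\,1\le j\le N}$ is isomorphic to $\bigoplus_{i=1}^N k[[t]]/(t^{e_i(\theta)})$. Suppose that $m\le N$, put $g=\lceil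 n/2\rceil$, let $0\le e_1\le e_2\le\cdots\le e_m<g$ be integers, and put $e_0=0$ and $e=e_1+\cdots+e_m$. Let $\mathcal{L}_n^{e_1,\ldots,e_m}(X)$ be the set of all $\theta\in\mathcal{L}_n(X)$ with $e_i(\theta)=e_i$ for $i=1,\ldots,m$ and, if $m<N$, $e_{m+1}(\theta)\ge g$. Locally closed sets are considered as varieties with their reduced structure. A trivial fibration with fibre $\mathbb{A}^s$ is a map $E\to B$ for which there is an isomorphism $E\cong B\times\mathbb{A}^s$ over $B$; a locally trivial fibration with fibre $\mathbb{A}^s$ is one that becomes trivial with fibre $\mathbb{A}^s$ over a Zariski open neighbourhood of each point of $B$. Then the following hold. (a) For $l\in\{e_m,e_m+1,\ldots,n\}$, the set $\pi^n_l(\mathcal{L}_n^{e_1,\ldots,e_m}(X))$ is locally closed in $\mathcal{L}_l(\mathbb{A}^N)$. (b) For every $\gamma\in\pi^n_{e_m}(\mathcal{L}_n^{e_1,\ldots,e_m}(X))$ there is an open subset $U_{e_m}$ of $\pi^n_{e_m}(\mathcal{L}_n^{e_1,\ldots,e_m}(X))$ containing $\gamma$ such that, if $U_i$ denotes the inverse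 image of $U_{e_m}$ under the truncation map $\pi^n_i(\mathcal{L}_n^{e_1,\ldots,e_m}(X))\to\pi^n_{e_m}(\mathcal{L}_n^{e_1,\ldots,e_m}(X))$ for $i\in\{e_m+1,\ldots,n\}$, then for every $l\in\{e_m,\ldots,n-1\}$ the truncation map $U_{l+1}\to U_l$ is a trivial fibration with fibre $\mathbb{A}^{N-a}$, where $a$ is the largest number of $\{0,\ldots,m\}$ satisfying $e_a<n-l$. (c) For $n>l\ge e_m$, the truncation map $\mathcal{L}_n^{e_1,\ldots,e_m}(X)\to\pi^n_l(\mathcal{L}_n^{e_1,\ldots,e_m}(X))$ is a locally trivial fibration with fibre an affine space $\mathbb{A}^s$ for some $s \ge 0$. If $l\le n-e_m$, then this holds with $s=(N-m)(n-l)+e$. If $l=e_m$ and $m<N$, then this holds with an $s\ge\lceil (N-m+1)(n/2)\rceil$. -/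

import Mathlib

noncomputable section

namespace JetFib

/-! ### The Zariski topology on affine space, regular maps and fibrations

Over an algebraically closed field, a reduced (quasi-affine) variety is described by its set of closed
points, a locally closed subset of an affine space `ι → k`. -/

section Affine

variable {k : Type*} [Field k] {ι κ : Type*}

/-- The common zeros in `k ^ ι` of a set of polynomials. -/
def zeros (P : Set (MvPolynomial ι k)) : Set (ι → k) :=
  {x | ∀ p ∈ P, MvPolynomial.eval x p = 0}

/-- The Zariski topology on `k ^ ι`: the closed sets are the sets of common zeros of polynomials. -/
@[reducible] def zariski (k : Type*) [Field k] (ι : Type*) : TopologicalSpace (ι → k) :=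
  TopologicalSpace.ofClosed {Z | ∃ P : Set (MvPolynomial ι k), Z = zeros P}
    ⟨{1}, by ext x; simp [zeros]⟩
    (by
      intro A hA
      refine ⟨{p | ∃ Z ∈ A, ∀ x ∈ Z, MvPolynomial.eval x p = 0}, ?_⟩
      ext x
      constructor
      · rintro hx p ⟨Z, hZ, hp⟩
        exact hp x (hx Z hZ)
      · intro hx Z hZ
        obtain ⟨P, rfl⟩ := hA hZ
        intro p hp
        exact hx p ⟨_, hZ, fun y hy => hy p hp⟩)
    (by
      rintro _ ⟨P, rfl⟩ _ ⟨Q, rfl⟩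
      refine ⟨{r | ∃ p ∈ P, ∃ q ∈ Q, r = p * q}, ?_⟩
      ext x
      constructor
      · rintro (hx | hx) _ ⟨p, hp, q, hq, rfl⟩
        · rw [map_mul, hx p hp, zero_mul]
        · rw [map_mul, hx q hq, mul_zero]
      · intro hx
        by_contra hcon
        simp only [Set.mem_union, not_or, zeros, Set.mem_ofPred_eq, not_forall] at hcon
        obtain ⟨⟨p, hp, hp0⟩, ⟨q, hq, hq0⟩⟩ := hcon
        have h := hx (p * q) ⟨p, hp, q, hq, rfl⟩
        rw [map_mul] at h
        exact (mul_ne_zero hp0 hq0) h)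

/-- `S` is a Zariski locally closed subset of `k ^ ι`. -/
def IsLocClosed (S : Set (ι → k)) : Prop := @IsLocallyClosed _ (zariski k ι) S

/-- `U` is a relatively open subset of `T`, for the Zariski topology. -/
def IsOpenIn (U T : Set (ι → k)) : Prop := ∃ O, @IsOpen _ (zariski k ι) O ∧ U = T ∩ O

/-- `φ` is a regular function on `S`: near every point of `S` it is a quotient of polynomials.
(The sets `S ∩ {q ≠ 0}` form a basis of the topology of `S`.) -/
def IsRegularFun (S : Set (ι → k)) (φ : (ι → k) → k) : Prop :=
  ∀ x ∈ S, ∃ p q : MvPolynomial ι k, MvPolynomial.eval x q ≠ 0 ∧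
    ∀ y ∈ S, MvPolynomial.eval y q ≠ 0 → φ y = MvPolynomial.eval y p / MvPolynomial.eval y q

/-- `Φ` restricts to a morphism from `S` to `T`, both with their reduced structure. -/
def IsMorphism (S : Set (ι → k)) (T : Set (κ → k)) (Φ : (ι → k) → (κ → k)) : Prop :=
  Set.MapsTo Φ S T ∧ ∀ j, IsRegularFun S (fun x => Φ x j)

/-- The product `B × 𝔸^s`, as a subset of `k ^ (κ ⊕ Fin s)`. -/
def prodAffine (B : Set (κ → k)) (s : ℕ) : Set (κ ⊕ Fin s → k) :=
  {z | (fun i => z (Sum.inl i)) ∈ B}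

/-- The map `p : E → B` is a trivial fibration with fibre `𝔸^s`: there is an isomorphism
`E ≅ B × 𝔸^s` of varieties which is compatible with `p` and the projection to `B`. -/
def IsTrivialFibration (p : (ι → k) → (κ → k)) (E : Set (ι → k)) (B : Set (κ → k)) (s : ℕ) :
    Prop :=
  ∃ (Φ : (ι → k) → (κ ⊕ Fin s → k)) (Ψ : (κ ⊕ Fin s → k) → (ι → k)),
    IsMorphism E (prodAffine B s) Φ ∧ IsMorphism (prodAffine B s) E Ψ ∧
    Set.LeftInvOn Ψ Φ E ∧ Set.RightInvOn Ψ Φ (prodAffine B s) ∧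
    ∀ x ∈ E, (fun i => Φ x (Sum.inl i)) = p x

/-- The map `p : E → B` is a (Zariski) locally trivial fibration with fibre `𝔸^s`. -/
def IsLocallyTrivialFibration (p : (ι → k) → (κ → k)) (E : Set (ι → k)) (B : Set (κ → k))
    (s : ℕ) : Prop :=
  Set.MapsTo p E B ∧
    ∀ b ∈ B, ∃ V, IsOpenIn V B ∧ b ∈ V ∧ IsTrivialFibration p (E ∩ p ⁻¹' V) V s

end Affine

/-! ### Jets and the invariant factors of the Jacobian matrix -/

section Jets

/-- The ring `k[[t]] / (t ^ r)`. -/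
abbrev TruncSeries (k : Type*) [Field k] (r : ℕ) : Type _ :=
  PowerSeries k ⧸ Ideal.span {(PowerSeries.X : PowerSeries k) ^ r}

variable {k : Type*} [Field k] {N m : ℕ}

/-- The closed points of the scheme `𝓛_n(𝔸^N)` of `n`-jets of affine space: an `n`-jet is given by
its coordinates `a (i, j)`, with `i < N` and `j ≤ n`. -/
abbrev AffineJet (k : Type*) (N n : ℕ) : Type _ := Fin N × Fin (n + 1) → k

/-- The `i`-th component `∑ j, a (i, j) t ^ j` modulo `t ^ (n + 1)` of an `n`-jet. -/
def jetSeries {n : ℕ} (a : AffineJet k N n) (i : Fin N) : TruncSeries k (n + 1) :=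
  Ideal.Quotient.mk _
    (∑ j : Fin (n + 1), PowerSeries.C (a (i, j)) * PowerSeries.X ^ (j : ℕ))

/-- The truncation map `π^n_l`, used for `l ≤ n`. -/
def trunc {n : ℕ} (l : ℕ) (a : AffineJet k N n) : AffineJet k N l :=
  fun ij => if h : (ij.2 : ℕ) < n + 1 then a (ij.1, ⟨ij.2, h⟩) else 0

/-- `𝓛_n(X)`, for the closed subscheme `X` of `𝔸^N` with ideal `I`. -/
def jets (I : Ideal (MvPolynomial (Fin N) k)) (n : ℕ) : Set (AffineJet k N n) :=
  {a | ∀ p ∈ I, MvPolynomial.aeval (jetSeries a) p = 0}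

/-- The Jacobian matrix of `f_1, …, f_m` evaluated in an `n`-jet. -/
def jacobian (f : Fin m → MvPolynomial (Fin N) k) {n : ℕ} (a : AffineJet k N n) :
    Matrix (Fin m) (Fin N) (TruncSeries k (n + 1)) :=
  Matrix.of fun i j => MvPolynomial.aeval (jetSeries a) (MvPolynomial.pderiv j (f i))

/-- The `k[[t]]`-module `M_n(f_1, …, f_m; θ)`: the quotient of `(k[[t]] / (t ^ (n + 1))) ^ N` by the
submodule generated by the rows of the Jacobian matrix. -/
abbrev JacModule (f : Fin m → MvPolynomial (Fin N) k) {n : ℕ} (a : AffineJet k N n) : Type _ :=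
  (Fin N → TruncSeries k (n + 1)) ⧸
    Submodule.span (PowerSeries k) (Set.range fun i => jacobian f a i)

/-- `ε 0 ≤ … ≤ ε (N - 1)` is the sequence `e_1(f_1, …, f_m; θ) ≤ … ≤ e_N(f_1, …, f_m; θ)` (which is
uniquely determined by this property). -/
def IsInvariantSeq (f : Fin m → MvPolynomial (Fin N) k) {n : ℕ} (a : AffineJet k N n)
    (ε : Fin N → ℕ) : Prop :=
  Monotone ε ∧ (∀ i, ε i ≤ n + 1) ∧
    Nonempty (JacModule f a ≃ₗ[PowerSeries k] ((i : Fin N) → TruncSeries k (ε i)))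

/-- The number `g`: `n / 2` if `n` is even and `(n + 1) / 2` if `n` is odd. -/
def halfUp (n : ℕ) : ℕ := if Even n then n / 2 else (n + 1) / 2

/-- `𝓛_n^{e_1, …, e_b}(X)`: the `n`-jets `θ` on `X` with `e_i(f_1, …, f_m; θ) = e i` for
`i = 1, …, b`, and `e_{b + 1}(f_1, …, f_m; θ) ≥ g` if `b < N`. Here `X` is the closed subscheme of
`𝔸^N` with ideal `I = (f_1, …, f_m)`. The entry `e_i` of the sequence of invariants is
`ε (i - 1)`. -/
def jetStratum (I : Ideal (MvPolynomial (Fin N) k)) (f : Fin m → MvPolynomial (Fin N) k)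
    (n b : ℕ) (e : ℕ → ℕ) : Set (AffineJet k N n) :=
  jets I n ∩ {a | ∃ ε : Fin N → ℕ, IsInvariantSeq f a ε ∧
    (∀ i : Fin N, (i : ℕ) < b → ε i = e (i + 1)) ∧
    (∀ i : Fin N, (i : ℕ) = b → halfUp n ≤ ε i)}

/-- `π^n_l(𝓛_n^{e_1, …, e_b}(X))`. -/
def truncStratum (I : Ideal (MvPolynomial (Fin N) k)) (f : Fin m → MvPolynomial (Fin N) k)
    (n b : ℕ) (e : ℕ → ℕ) (l : ℕ) : Set (AffineJet k N l) :=
  trunc l '' jetStratum I f n b e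

end Jets

end JetFib

end

open JetFib

/-!
Write `O = k⟦X⟧`, lift a jet `θ` to the vector `jetLift θ` of polynomials in `X`, and let `J` be
the Jacobian matrix in this lift (`liftJac`), `f(θ)` the vector of values (`liftVal`) and
`L = J O ^ N` the column space of `J`.

The invariants of `θ` and the ranks over `k` of the truncations `toeplitz i J` of `J` modulo
`X ^ i` determine each other: the rank of the truncation modulo `X ^ i` is the sum of the truncated
differences `i - e_j` (`IsInvariantSeq.rank_toeplitz`, `mem_jetStratum_iff`). In particular, the
rank grows by `m` from order `e_m` to order `e_m + 1`, so that `X ^ e_m O ^ m ⊆ L`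
(`HasInvariants.X_pow_smul_mem_range`). By Nakayama's lemma, `L` only depends on the truncation of
`θ` to order `e_m`.

If `θ` is an `(l + 1)`-jet with truncation `θ'` and last coefficients `v`, and `l ≥ e_m`, then
Taylor's formula gives `f(θ) = f(θ') + X ^ (l + 1) J v` up to an element of `X ^ (l + 2) L`. It
follows, as in Hensel's lemma, that an `l`-jet lifts to the stratum of `n`-jets exactly if its
truncation to order `e_m` has the right ranks and `f(θ) ∈ X ^ (l + 1) L + X ^ (n + 1) O ^ m`
(`truncStratum_eq_truncModel`). These are conditions on ranks of matrices with polynomial entries,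
whence the image of the stratum is locally closed (`isLocClosed_truncModel`).

The fibre over an `l`-jet in the image is the set of solutions `v` of a system of linear equations
with values in `(X ^ (l + 1) L + X ^ (n + 1) O ^ m) / (X ^ (l + 2) L + X ^ (n + 1) O ^ m)`, a
space whose dimension is the number of `j` with `e_j < n - l`. As all the ranks are constant,
cofactors of minors that do not vanish in a given jet write this system near that jet with
polynomial coefficients (`leftKer`), and a second nonvanishing minor solves it
(`isTrivialFibration_of_linear`). Both minors are polynomials in the truncation to order `e_m`, so
one open set serves all `l` (`exists_isTrivialFibration_trunc`). The truncation map from the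
`n`-jets is a composition of these fibrations, and its fibre dimension is a telescoping sum
(`sum_fibreDim_add_expectedRank`).
-/

noncomputable section

namespace JetFib

/-! ### Minors and matrices of constant rank -/

section Rank

variable {k : Type*} [Field k] {ι κ : Type*} [Fintype κ]

/-- A matrix of rank at least `r` has a nonzero minor of size `r`. -/
theorem exists_submatrix_det_ne_zero [Finite ι] (A : Matrix ι κ k) {r : ℕ} (hr : r ≤ A.rank) :
    ∃ (s : Fin r → ι) (u : Fin r → κ), (A.submatrix s u).det ≠ 0 := by
  rw [Matrix.rank_eq_finrank_span_row] at hr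
  obtain ⟨F, hF, -, hli⟩ := Submodule.exists_fun_fin_finrank_span_eq k (Set.range A.row)
  choose s hs using hF
  have hs' : LinearIndependent k (A.submatrix (s ∘ Fin.castLE hr) id).row := by
    have := hli.comp (Fin.castLE hr) (Fin.castLE_injective hr)
    rwa [show F ∘ Fin.castLE hr = (A.submatrix (s ∘ Fin.castLE hr) id).row from
      funext fun i => (hs _).symm] at this
  have hrk := hs'.rank_matrix
  rw [Fintype.card_fin, Matrix.rank_eq_finrank_span_cols] at hrk
  obtain ⟨G, hG, -, hli'⟩ := Submodule.exists_fun_fin_finrank_span_eq k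
    (Set.range (A.submatrix (s ∘ Fin.castLE hr) id).col)
  choose u hu using hG
  refine ⟨s ∘ Fin.castLE hr, u ∘ Fin.cast hrk.symm, ?_⟩
  have h2 : LinearIndependent k
      (A.submatrix (s ∘ Fin.castLE hr) (u ∘ Fin.cast hrk.symm)).col := by
    have := hli'.comp (Fin.cast hrk.symm) (Fin.cast_injective _)
    rwa [show G ∘ Fin.cast hrk.symm =
      (A.submatrix (s ∘ Fin.castLE hr) (u ∘ Fin.cast hrk.symm)).col from
      funext fun i => (hu _).symm] at this
  rw [← isUnit_iff_ne_zero, ← Matrix.isUnit_iff_isUnit_det]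
  exact Matrix.linearIndependent_cols_iff_isUnit.mp h2

theorem le_rank_of_submatrix_det_ne_zero (A : Matrix ι κ k) {r : ℕ} {s : Fin r → ι} {u : Fin r → κ}
    (h : (A.submatrix s u).det ≠ 0) : r ≤ A.rank := by
  have := Matrix.rank_submatrix_le A s u
  rwa [Matrix.rank_of_det_ne_zero h, Fintype.card_fin] at this

/-- If `A` has rank at most `r` and an invertible `r × r` block in the rows `s`, then a solvable
system `A v = b` is equivalent to its equations with index in `s`. -/
theorem mulVec_eq_iff_of_rank_le (A : Matrix ι κ k) {r : ℕ} (hA : A.rank ≤ r) {s : Fin r → ι}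
    {u : Fin r → κ} (h : (A.submatrix s u).det ≠ 0) {b : ι → k} (hb : ∃ v, A.mulVec v = b)
    (v : κ → k) : A.mulVec v = b ↔ ∀ i, A.mulVec v (s i) = b (s i) := by
  refine ⟨fun h i => by rw [h], fun hv => ?_⟩
  obtain ⟨v₀, rfl⟩ := hb
  have hle : LinearMap.ker A.mulVecLin ≤ LinearMap.ker (A.submatrix s id).mulVecLin := by
    intro d hd
    rw [LinearMap.mem_ker, Matrix.mulVecLin_apply] at hd ⊢
    ext i
    exact congrFun hd (s i)
  have heq : LinearMap.ker A.mulVecLin = LinearMap.ker (A.submatrix s id).mulVecLin := by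
    apply Submodule.eq_of_le_of_finrank_le hle
    have h1 := LinearMap.finrank_range_add_finrank_ker A.mulVecLin
    have h2 := LinearMap.finrank_range_add_finrank_ker (A.submatrix s id).mulVecLin
    have h3 : r ≤ (A.submatrix s id).rank := by
      have := Matrix.rank_submatrix_le (A.submatrix s id) id u
      simp only [Matrix.submatrix_submatrix, Function.comp_id, Function.id_comp] at this
      rwa [Matrix.rank_of_det_ne_zero h, Fintype.card_fin] at this
    unfold Matrix.rank at hA h3
    omega
  have hmem : v - v₀ ∈ LinearMap.ker (A.submatrix s id).mulVecLin := by
    rw [LinearMap.mem_ker, Matrix.mulVecLin_apply]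
    ext i
    have := hv i
    change ((A.submatrix s id).mulVec (v - v₀)) i = 0
    rw [Matrix.mulVec_sub]
    exact sub_eq_zero.mpr this
  rw [← heq, LinearMap.mem_ker, map_sub, sub_eq_zero] at hmem
  exact hmem

/-- A matrix whose kernel is the column space of `A`, as soon as the block with rows `s` and columns
`u` is invertible and of the same rank as `A`. Denominators are cleared, so that the entries are
polynomials in those of `A`. -/
def leftKer {R : Type*} [CommRing R] {ι κ : Type*} [DecidableEq ι] (A : Matrix ι κ R)
    {r : ℕ} (s : Fin r → ι) (u : Fin r → κ) : Matrix ι ι R :=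
  (A.submatrix s u).det • (1 : Matrix ι ι R) -
    A.submatrix id u * (A.submatrix s u).adjugate * (1 : Matrix ι ι R).submatrix s id

theorem leftKer_mulVec {R : Type*} [CommRing R] {ι κ : Type*} [Fintype ι] [DecidableEq ι]
    (A : Matrix ι κ R) {r : ℕ} (s : Fin r → ι)
    (u : Fin r → κ) (y : ι → R) :
    (leftKer A s u).mulVec y = (A.submatrix s u).det • y -
      (A.submatrix id u).mulVec ((A.submatrix s u).adjugate.mulVec (y ∘ s)) := by
  have : ((1 : Matrix ι ι R).submatrix s id).mulVec y = y ∘ s := by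
    ext i
    simp [Matrix.mulVec, dotProduct, Matrix.one_apply]
  rw [leftKer, Matrix.sub_mulVec, Matrix.smul_mulVec, Matrix.one_mulVec, ← Matrix.mulVec_mulVec,
    ← Matrix.mulVec_mulVec, this]

theorem map_leftKer {R S : Type*} [CommRing R] [CommRing S] {ι κ : Type*} [DecidableEq ι]
    (g : R →+* S) (A : Matrix ι κ R)
    {r : ℕ} (s : Fin r → ι) (u : Fin r → κ) :
    (leftKer A s u).map g = leftKer (A.map g) s u := by
  have h1 : (A.map g).submatrix s u = g.mapMatrix (A.submatrix s u) := rfl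
  have h2 : (1 : Matrix ι ι S) = (1 : Matrix ι ι R).map g := by simp
  unfold leftKer
  rw [h1, ← RingHom.map_adjugate, ← RingHom.map_det, h2, Matrix.map_sub g (map_sub g)]
  congr 1
  · ext i j
    simp only [Matrix.map_apply, Matrix.smul_apply, smul_eq_mul, map_mul]
  · rw [Matrix.map_mul, Matrix.map_mul]
    rfl

theorem leftKer_mulVec_eq_zero_iff [Fintype ι] [DecidableEq ι] (A : Matrix ι κ k) {r : ℕ}
    (hA : A.rank ≤ r) {s : Fin r → ι} {u : Fin r → κ} (h : (A.submatrix s u).det ≠ 0) (y : ι → k) :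
    (leftKer A s u).mulVec y = 0 ↔ ∃ w, A.mulVec w = y := by
  have hle : LinearMap.range (A.submatrix id u).mulVecLin ≤ LinearMap.range A.mulVecLin := by
    rw [Matrix.range_mulVecLin, Matrix.range_mulVecLin]
    apply Submodule.span_mono
    rintro _ ⟨i, rfl⟩
    exact ⟨u i, rfl⟩
  have heq : LinearMap.range (A.submatrix id u).mulVecLin = LinearMap.range A.mulVecLin := by
    apply Submodule.eq_of_le_of_finrank_le hle
    refine le_trans hA ?_
    have := Matrix.rank_submatrix_le (A.submatrix id u) s id
    simp only [Matrix.submatrix_submatrix, Function.comp_id, Function.id_comp] at this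
    rwa [Matrix.rank_of_det_ne_zero h, Fintype.card_fin] at this
  rw [leftKer_mulVec]
  constructor
  · intro hy
    have hy' : y = (A.submatrix id u).mulVecLin
        ((A.submatrix s u).det⁻¹ • (A.submatrix s u).adjugate.mulVec (y ∘ s)) := by
      rw [map_smul, Matrix.mulVecLin_apply, ← sub_eq_zero.mp hy, smul_smul, inv_mul_cancel₀ h,
        one_smul]
    have : y ∈ LinearMap.range A.mulVecLin := by
      rw [← heq, hy']
      exact LinearMap.mem_range_self _ _
    exact this
  · rintro ⟨w, hw⟩
    have : y ∈ LinearMap.range (A.submatrix id u).mulVecLin := by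
      rw [heq]
      exact ⟨w, hw⟩
    obtain ⟨z, rfl⟩ := this
    have h1 : (A.submatrix id u).mulVecLin z ∘ s = (A.submatrix s u).mulVec z := rfl
    rw [h1, Matrix.mulVec_mulVec (v := z), Matrix.adjugate_mul, Matrix.smul_mulVec,
      Matrix.one_mulVec, Matrix.mulVec_smul, Matrix.mulVecLin_apply, sub_self]

end Rank

/-! ### Regular functions and the Zariski topology -/

section Geometry

variable {k : Type*} [Field k] {ι κ μ : Type*}

theorem isClosed_zariski_iff {Z : Set (ι → k)} :
    @IsClosed _ (zariski k ι) Z ↔ ∃ P : Set (MvPolynomial ι k), Z = zeros P := by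
  rw [← @isOpen_compl_iff _ _ (zariski k ι)]
  change Zᶜᶜ ∈ _ ↔ _
  rw [compl_compl]
  rfl

theorem isOpen_zariski_ne_zero (p : MvPolynomial ι k) :
    @IsOpen _ (zariski k ι) {x | MvPolynomial.eval x p ≠ 0} := by
  rw [← @isClosed_compl_iff _ (zariski k ι), isClosed_zariski_iff]
  refine ⟨{p}, ?_⟩
  ext x
  simp [zeros]

theorem isClosed_rank_le [Finite ι] [Fintype κ]
    (M : Matrix ι κ (MvPolynomial μ k)) (r : ℕ) :
    @IsClosed _ (zariski k μ) {x | (M.map (MvPolynomial.eval x)).rank ≤ r} := by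
  rw [isClosed_zariski_iff]
  refine ⟨{p | ∃ (s : Fin (r + 1) → ι) (u : Fin (r + 1) → κ), p = (M.submatrix s u).det}, ?_⟩
  have key : ∀ (x : μ → k) (s : Fin (r + 1) → ι) (u : Fin (r + 1) → κ),
      MvPolynomial.eval x (M.submatrix s u).det
        = ((M.map (MvPolynomial.eval x)).submatrix s u).det := by
    intro x s u
    rw [RingHom.map_det]
    rfl
  ext x
  constructor
  · rintro hx _ ⟨s, u, rfl⟩
    by_contra hne
    rw [key] at hne
    have := le_rank_of_submatrix_det_ne_zero _ hne
    simp only [Set.mem_ofPred_eq] at hx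
    omega
  · intro hx
    simp only [Set.mem_ofPred_eq]
    by_contra hlt
    obtain ⟨s, u, hne⟩ := exists_submatrix_det_ne_zero _ (r := r + 1) (not_le.mp hlt)
    rw [← key] at hne
    exact hne (hx _ ⟨s, u, rfl⟩)

theorem isRegularFun_eval (S : Set (ι → k)) (p : MvPolynomial ι k) :
    IsRegularFun S (fun x => MvPolynomial.eval x p) :=
  fun x _ => ⟨p, 1, by simp, fun y _ _ => by simp⟩

theorem isRegularFun_const (S : Set (ι → k)) (c : k) : IsRegularFun S (fun _ => c) := by
  simpa using isRegularFun_eval S (MvPolynomial.C c)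

theorem isRegularFun_coord (S : Set (ι → k)) (i : ι) : IsRegularFun S (fun x => x i) := by
  simpa using isRegularFun_eval S (MvPolynomial.X i)

theorem IsRegularFun.congr {S : Set (ι → k)} {φ ψ : (ι → k) → k} (hφ : IsRegularFun S φ)
    (h : ∀ x ∈ S, ψ x = φ x) : IsRegularFun S ψ := by
  intro x hx
  obtain ⟨p, q, hq, hpq⟩ := hφ x hx
  exact ⟨p, q, hq, fun y hy hqy => (h y hy).trans (hpq y hy hqy)⟩

theorem IsRegularFun.add {S : Set (ι → k)} {φ ψ : (ι → k) → k} (hφ : IsRegularFun S φ)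
    (hψ : IsRegularFun S ψ) : IsRegularFun S (fun x => φ x + ψ x) := by
  intro x hx
  obtain ⟨p, q, hq, hpq⟩ := hφ x hx
  obtain ⟨p', q', hq', hpq'⟩ := hψ x hx
  refine ⟨p * q' + q * p', q * q', by simp [hq, hq'], fun y hy hne => ?_⟩
  rw [map_mul, mul_ne_zero_iff] at hne
  simp only [map_mul, map_add]
  rw [hpq y hy hne.1, hpq' y hy hne.2, div_add_div _ _ hne.1 hne.2]

theorem IsRegularFun.mul {S : Set (ι → k)} {φ ψ : (ι → k) → k} (hφ : IsRegularFun S φ)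
    (hψ : IsRegularFun S ψ) : IsRegularFun S (fun x => φ x * ψ x) := by
  intro x hx
  obtain ⟨p, q, hq, hpq⟩ := hφ x hx
  obtain ⟨p', q', hq', hpq'⟩ := hψ x hx
  refine ⟨p * p', q * q', by simp [hq, hq'], fun y hy hne => ?_⟩
  rw [map_mul, mul_ne_zero_iff] at hne
  simp only [map_mul]
  rw [hpq y hy hne.1, hpq' y hy hne.2, div_mul_div_comm]

theorem IsRegularFun.neg {S : Set (ι → k)} {φ : (ι → k) → k} (hφ : IsRegularFun S φ) :
    IsRegularFun S (fun x => -φ x) := by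
  simpa using (isRegularFun_const S (-1)).mul hφ

theorem IsRegularFun.sub {S : Set (ι → k)} {φ ψ : (ι → k) → k} (hφ : IsRegularFun S φ)
    (hψ : IsRegularFun S ψ) : IsRegularFun S (fun x => φ x - ψ x) := by
  simpa [sub_eq_add_neg] using hφ.add hψ.neg

theorem IsRegularFun.sum {S : Set (ι → k)} {α : Type*} (s : Finset α) {φ : α → (ι → k) → k}
    (hφ : ∀ a, IsRegularFun S (φ a)) : IsRegularFun S (fun x => ∑ a ∈ s, φ a x) := by
  classical
  induction s using Finset.induction_on with
  | empty => simpa using isRegularFun_const S 0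
  | insert a s ha ih =>
    simp only [Finset.sum_insert ha]
    exact (hφ a).add ih

theorem IsRegularFun.inv {S : Set (ι → k)} {φ : (ι → k) → k} (hφ : IsRegularFun S φ)
    (h0 : ∀ x ∈ S, φ x ≠ 0) : IsRegularFun S (fun x => (φ x)⁻¹) := by
  intro x hx
  obtain ⟨p, q, hq, hpq⟩ := hφ x hx
  have hp : MvPolynomial.eval x p ≠ 0 := by
    intro hp
    exact h0 x hx (by rw [hpq x hx hq, hp, zero_div])
  refine ⟨q * q, p * q, by simp [hp, hq], fun y hy hne => ?_⟩
  rw [map_mul, mul_ne_zero_iff] at hne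
  simp only [map_mul]
  rw [hpq y hy hne.2, inv_div, mul_div_mul_right _ _ hne.2]

theorem IsRegularFun.eval_comp {S : Set (ι → k)} {Φ : (ι → k) → (κ → k)}
    (hΦ : ∀ j, IsRegularFun S (fun x => Φ x j)) (p : MvPolynomial κ k) :
    IsRegularFun S (fun x => MvPolynomial.eval (Φ x) p) := by
  induction p using MvPolynomial.induction_on with
  | C a => simpa using isRegularFun_const S a
  | add p q hp hq => simpa using hp.add hq
  | mul_X p i hp => simpa using hp.mul (hΦ i)

theorem IsRegularFun.comp {S : Set (ι → k)} {T : Set (κ → k)} {Φ : (ι → k) → (κ → k)}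
    {φ : (κ → k) → k} (hφ : IsRegularFun T φ) (hΦ : IsMorphism S T Φ) :
    IsRegularFun S (fun x => φ (Φ x)) := by
  intro x hx
  obtain ⟨p, q, hq, hpq⟩ := hφ (Φ x) (hΦ.1 hx)
  obtain ⟨c, d, hd, hcd⟩ := IsRegularFun.eval_comp hΦ.2 p x hx
  obtain ⟨a, b, hb, hab⟩ := IsRegularFun.eval_comp hΦ.2 q x hx
  have ha : MvPolynomial.eval x a ≠ 0 := by
    intro ha
    exact hq ((hab x hx hb).trans (by rw [ha, zero_div]))
  refine ⟨c * b * b, d * a * b, by simp [hd, ha, hb], fun y hy hne => ?_⟩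
  rw [map_mul, map_mul, mul_ne_zero_iff, mul_ne_zero_iff] at hne
  obtain ⟨⟨hd', ha'⟩, hb'⟩ := hne
  have hqy : MvPolynomial.eval (Φ y) q = _ := hab y hy hb'
  have hpy : MvPolynomial.eval (Φ y) p = _ := hcd y hy hd'
  simp only [map_mul]
  rw [hpq _ (hΦ.1 hy) (by rw [hqy]; exact div_ne_zero ha' hb'), hqy, hpy]
  field_simp

theorem IsMorphism.comp {S : Set (ι → k)} {T : Set (κ → k)} {W : Set (μ → k)}
    {Φ : (ι → k) → (κ → k)} {Ψ : (κ → k) → (μ → k)} (hΨ : IsMorphism T W Ψ)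
    (hΦ : IsMorphism S T Φ) : IsMorphism S W (fun x => Ψ (Φ x)) :=
  ⟨hΨ.1.comp hΦ.1, fun j => (hΨ.2 j).comp hΦ⟩

theorem IsRegularFun.det {S : Set (ι → k)} {α : Type*} [Fintype α] [DecidableEq α]
    {A : (ι → k) → Matrix α α k} (hA : ∀ i j, IsRegularFun S (fun x => A x i j)) :
    IsRegularFun S (fun x => (A x).det) := by
  have := IsRegularFun.eval_comp (S := S) (Φ := fun x (ij : α × α) => A x ij.1 ij.2)
    (fun ij => hA ij.1 ij.2) (Matrix.det (Matrix.of fun i j => MvPolynomial.X (i, j)))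
  refine this.congr fun x _ => ?_
  rw [RingHom.map_det]
  congr 1
  ext i j
  simp

theorem IsRegularFun.matrix_inv {S : Set (ι → k)} {α : Type*} [Fintype α] [DecidableEq α]
    {A : (ι → k) → Matrix α α k} (hA : ∀ i j, IsRegularFun S (fun x => A x i j))
    (h0 : ∀ x ∈ S, (A x).det ≠ 0) (i j : α) : IsRegularFun S (fun x => (A x)⁻¹ i j) := by
  have hadj : IsRegularFun S (fun x => (A x).adjugate i j) := by
    simp only [Matrix.adjugate_apply]
    refine IsRegularFun.det fun a b => ?_
    by_cases h : a = j
    · subst h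
      simpa using isRegularFun_const S _
    · simpa [Matrix.updateRow_apply, h] using hA a b
  refine (((IsRegularFun.det hA).inv h0).mul hadj).congr fun x _ => ?_
  simp [Matrix.inv_def]

theorem isTrivialFibration_id {p : (ι → k) → (ι → k)} (hp : ∀ x, p x = x) (E : Set (ι → k)) :
    IsTrivialFibration p E E 0 := by
  refine ⟨fun x => Sum.elim x Fin.elim0, fun z i => z (Sum.inl i), ⟨fun x hx => hx, ?_⟩,
    ⟨fun z hz => hz, fun j => isRegularFun_coord _ _⟩, fun x _ => rfl, ?_, fun x _ => (hp x).symm⟩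
  · rintro (j | j)
    · exact isRegularFun_coord _ _
    · exact j.elim0
  · intro z _
    ext (i | i)
    · rfl
    · exact i.elim0

/-- Trivial fibrations compose, and the dimensions of the fibres add up. -/
theorem IsTrivialFibration.comp {E : Set (ι → k)} {B : Set (κ → k)} {C : Set (μ → k)}
    {p : (ι → k) → (κ → k)} {q : (κ → k) → (μ → k)} {pq : (ι → k) → (μ → k)} {r s : ℕ}
    (hpq : ∀ x, pq x = q (p x)) (hp : IsTrivialFibration p E B s)
    (hq : IsTrivialFibration q B C r) : IsTrivialFibration pq E C (r + s) := by
  obtain ⟨Φ, Ψ, hΦ, hΨ, hl, hr, hc⟩ := hp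
  obtain ⟨Φ', Ψ', hΦ', hΨ', hl', hr', hc'⟩ := hq
  have hpE : ∀ x ∈ E, p x ∈ B := fun x hx => by rw [← hc x hx]; exact hΦ.1 hx
  have hpm : IsMorphism E B p :=
    ⟨hpE, fun j => (hΦ.2 (Sum.inl j)).congr fun x hx => (congrFun (hc x hx) j).symm⟩
  -- the two fibre coordinates are concatenated by `finSumFinEquiv`
  let Θ : (ι → k) → (μ ⊕ Fin (r + s) → k) := fun x => Sum.elim (fun i => Φ' (p x) (Sum.inl i))
    (fun j => Sum.elim (fun a => Φ' (p x) (Sum.inr a)) (fun b => Φ x (Sum.inr b))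
      (finSumFinEquiv.symm j))
  let fst : (μ ⊕ Fin (r + s) → k) → (μ ⊕ Fin r → k) := fun z =>
    Sum.elim (fun i => z (Sum.inl i)) (fun a => z (Sum.inr (finSumFinEquiv (Sum.inl a))))
  let mid : (μ ⊕ Fin (r + s) → k) → (κ ⊕ Fin s → k) := fun z =>
    Sum.elim (Ψ' (fst z)) (fun b => z (Sum.inr (finSumFinEquiv (Sum.inr b))))
  have hfst : IsMorphism (prodAffine C (r + s)) (prodAffine C r) fst := by
    refine ⟨fun z hz => hz, ?_⟩
    rintro (j | j) <;> exact isRegularFun_coord _ _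
  have hmid : IsMorphism (prodAffine C (r + s)) (prodAffine B s) mid := by
    refine ⟨fun z hz => hΨ'.1 (hfst.1 hz), ?_⟩
    rintro (j | j)
    · exact (hΨ'.2 j).comp hfst
    · exact isRegularFun_coord _ _
  have hΘm : Set.MapsTo Θ E (prodAffine C (r + s)) := fun x hx => hΦ'.1 (hpE x hx)
  have hfstΘ : ∀ x, fst (Θ x) = Φ' (p x) := by
    intro x
    ext (i | i) <;> simp [fst, Θ]
  refine ⟨Θ, fun z => Ψ (mid z), ⟨hΘm, ?_⟩, hΨ.comp hmid, ?_, ?_, ?_⟩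
  · rintro (j | j)
    · exact (hΦ'.2 (Sum.inl j)).comp hpm
    · obtain ⟨a | b, rfl⟩ := finSumFinEquiv.surjective j
      · simpa only [Θ, Sum.elim_inr, Equiv.symm_apply_apply, Sum.elim_inl] using
          (hΦ'.2 (Sum.inr a)).comp hpm
      · simpa only [Θ, Sum.elim_inr, Equiv.symm_apply_apply, Sum.elim_inl] using hΦ.2 (Sum.inr b)
  · intro x hx
    have : mid (Θ x) = Φ x := by
      ext (i | i)
      · simp only [mid, Sum.elim_inl, hfstΘ]
        rw [hl' (hpE x hx), ← hc x hx]
      · simp [mid, Θ]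
    change Ψ (mid (Θ x)) = x
    rw [this, hl hx]
  · intro z hz
    have h1 : Φ (Ψ (mid z)) = mid z := hr (hmid.1 hz)
    have h2 : p (Ψ (mid z)) = Ψ' (fst z) := by
      rw [← hc _ (hΨ.1 (hmid.1 hz)), h1]
      rfl
    have h3 : Φ' (Ψ' (fst z)) = fst z := hr' (hfst.1 hz)
    ext (i | j)
    · simp only [Θ, h2, h3, Sum.elim_inl]
      rfl
    · obtain ⟨a | b, rfl⟩ := finSumFinEquiv.surjective j
      · simp only [Θ, h2, h3, Equiv.symm_apply_apply, Sum.elim_inl, Sum.elim_inr]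
        rfl
      · simp only [Θ, h1, Equiv.symm_apply_apply, Sum.elim_inr]
        rfl
  · intro x hx
    rw [hpq, ← hc' _ (hpE x hx)]
    rfl

/-- The solutions of a solvable system `A v = b` of linear equations with regular coefficients form
a trivial fibration over `S`, if `A` has rank at most `a` on `S` and some fixed `a × a` block of `A`
is invertible all over `S`: the unknowns outside the block are free. -/
theorem isTrivialFibration_of_linear {N a : ℕ} {ρ : Type*} [Fintype ρ] [DecidableEq ρ]
    (σ : κ ⊕ Fin N ≃ ι)
    {p : (ι → k) → (κ → k)} (hp : ∀ x i, p x i = x (σ (Sum.inl i))) {S : Set (κ → k)}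
    {E : Set (ι → k)} {A : (κ → k) → Matrix ρ (Fin N) k} {b : (κ → k) → ρ → k}
    (hA : ∀ i j, IsRegularFun S (fun x => A x i j)) (hb : ∀ i, IsRegularFun S (fun x => b x i))
    (hE : ∀ x, x ∈ E ↔ p x ∈ S ∧ (A (p x)).mulVec (fun j => x (σ (Sum.inr j))) = b (p x))
    (hsolv : ∀ x ∈ S, ∃ v, (A x).mulVec v = b x) (hrank : ∀ x ∈ S, (A x).rank ≤ a)
    {s : Fin a → ρ} {u : Fin a → Fin N} (hu : Function.Injective u)
    (hdet : ∀ x ∈ S, ((A x).submatrix s u).det ≠ 0) :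
    IsTrivialFibration p E S (N - a) := by
  classical
  -- `τ` splits the unknowns into those of the block and the free ones
  obtain ⟨τ, hτ⟩ : ∃ τ : Fin a ⊕ Fin (N - a) ≃ Fin N, ∀ i, τ (Sum.inl i) = u i := by
    have hcard : Fintype.card {j // j ∉ Set.range u} = N - a := by
      have h := Set.card_range_of_injective hu
      rw [Fintype.card_fin] at h
      rw [Fintype.card_subtype_compl, Fintype.card_fin]
      exact congrArg (N - ·) h
    refine ⟨(Equiv.sumCongr (Equiv.ofInjective u hu) (Fintype.equivFinOfCardEq hcard).symm).trans
      (Equiv.sumCompl (· ∈ Set.range u)), fun i => ?_⟩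
    simp
  let B : (κ → k) → Matrix (Fin a) (Fin a) k := fun y => (A y).submatrix s u
  let D : (κ → k) → Matrix (Fin a) (Fin (N - a)) k := fun y =>
    (A y).submatrix s (fun i => τ (Sum.inr i))
  -- the equations with index in `s`, split according to `τ`
  have hsplit : ∀ (y : κ → k) (v : Fin N → k) (i : Fin a), (A y).mulVec v (s i) =
      (B y).mulVec (fun j => v (u j)) i + (D y).mulVec (fun j => v (τ (Sum.inr j))) i := by
    intro y v i
    simp only [Matrix.mulVec, dotProduct, B, D, Matrix.submatrix_apply]
    rw [← Equiv.sum_comp τ, Fintype.sum_sum_type]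
    simp [hτ]
  let V : (κ → k) → (Fin (N - a) → k) → Fin N → k := fun y w j =>
    Sum.elim ((B y)⁻¹.mulVec ((fun i => b y (s i)) - (D y).mulVec w)) w (τ.symm j)
  have hVu : ∀ y w, (fun j => V y w (u j)) =
      (B y)⁻¹.mulVec ((fun i => b y (s i)) - (D y).mulVec w) := by
    intro y w
    ext j
    simp [V, ← hτ]
  have hVr : ∀ y w, (fun j => V y w (τ (Sum.inr j))) = w := by
    intro y w
    ext j
    simp [V]
  have hVsol : ∀ y ∈ S, ∀ w, (A y).mulVec (V y w) = b y := by
    intro y hy w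
    rw [mulVec_eq_iff_of_rank_le (A y) (hrank y hy) (hdet y hy) (hsolv y hy)]
    intro i
    rw [hsplit, hVu, hVr, Matrix.mulVec_mulVec, Matrix.mul_nonsing_inv _ (hdet y hy).isUnit,
      Matrix.one_mulVec]
    simp
  have hVuniq : ∀ y ∈ S, ∀ v, (A y).mulVec v = b y → V y (fun j => v (τ (Sum.inr j))) = v := by
    intro y hy v hv
    ext j
    obtain ⟨i | i, rfl⟩ := τ.surjective j
    · have h1 : (B y).mulVec (fun j => v (u j)) =
          (fun i => b y (s i)) - (D y).mulVec (fun j => v (τ (Sum.inr j))) := by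
        ext i
        have := hsplit y v i
        rw [hv] at this
        simp [this]
      rw [hτ]
      refine (congrFun (hVu y _) i).trans ?_
      rw [← h1, Matrix.mulVec_mulVec, Matrix.nonsing_inv_mul _ (hdet y hy).isUnit,
        Matrix.one_mulVec]
    · exact congrFun (hVr y _) i
  let Ψ : (κ ⊕ Fin (N - a) → k) → (ι → k) := fun z i =>
    Sum.elim (fun i => z (Sum.inl i)) (V (fun i => z (Sum.inl i)) (fun j => z (Sum.inr j)))
      (σ.symm i)
  have hpΨ : ∀ z, p (Ψ z) = fun i => z (Sum.inl i) := by
    intro z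
    ext i
    simp [hp, Ψ]
  have hvΨ : ∀ z, (fun j => Ψ z (σ (Sum.inr j))) =
      V (fun i => z (Sum.inl i)) (fun j => z (Sum.inr j)) := by
    intro z
    ext j
    simp [Ψ]
  have hfst : IsMorphism (prodAffine S (N - a)) S (fun z i => z (Sum.inl i)) :=
    ⟨fun z hz => hz, fun j => isRegularFun_coord _ _⟩
  refine ⟨fun x => Sum.elim (p x) (fun j => x (σ (Sum.inr (τ (Sum.inr j))))), Ψ, ⟨?_, ?_⟩,
    ⟨?_, ?_⟩, ?_, ?_, fun x _ => rfl⟩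
  · intro x hx
    exact ((hE x).mp hx).1
  · rintro (j | j)
    · simpa [hp] using isRegularFun_coord E _
    · exact isRegularFun_coord _ _
  · intro z hz
    rw [hE, hpΨ, hvΨ]
    exact ⟨hz, hVsol _ hz _⟩
  · intro i
    obtain ⟨j | j, rfl⟩ := σ.surjective i
    · simpa [Ψ] using isRegularFun_coord _ _
    · obtain ⟨c | c, rfl⟩ := τ.surjective j
      · simp only [Ψ, Equiv.symm_apply_apply, Sum.elim_inr, V, Sum.elim_inl, Matrix.mulVec,
          dotProduct, Pi.sub_apply]
        refine IsRegularFun.sum _ fun d => ?_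
        refine ((IsRegularFun.matrix_inv (S := S) (A := B) (fun i j => hA _ _) hdet c d).comp
          hfst).mul (((hb _).comp hfst).sub (IsRegularFun.sum _ fun f => ?_))
        exact ((hA _ _).comp hfst).mul (isRegularFun_coord _ _)
      · simpa [Ψ, V] using isRegularFun_coord _ _
  · intro x hx
    obtain ⟨h1, h2⟩ := (hE x).mp hx
    ext i
    obtain ⟨j | j, rfl⟩ := σ.surjective i
    · simp [Ψ, hp]
    · simpa [Ψ] using congrFun (hVuniq _ h1 _ h2) j
  · intro z hz
    ext (i | j)
    · simp [hpΨ]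
    · simpa [Ψ] using congrFun (hVr _ _) j

end Geometry

/-! ### Truncated matrices of power series -/

section Toeplitz

open PowerSeries

/-- The coefficients of order less than `q` of a vector of power series. -/
def jetCoeffs (R : Type*) [CommRing R] (ι : Type*) (q : ℕ) : (ι → R⟦X⟧) →ₗ[R] (ι × Fin q → R) where
  toFun y x := coeff (x.2 : ℕ) (y x.1)
  map_add' y z := by ext; simp
  map_smul' c y := by ext; simp

/-- The matrix over `R` of the `R`-linear map `(R⟦X⟧ / X ^ q) ^ κ → (R⟦X⟧ / X ^ q) ^ ι` given by a
matrix `A` of power series, in the bases of the powers of `X`. -/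
def toeplitz {R : Type*} [CommRing R] {ι κ : Type*} (q : ℕ) (A : Matrix ι κ R⟦X⟧) :
    Matrix (ι × Fin q) (κ × Fin q) R :=
  Matrix.of fun x y => if (y.2 : ℕ) ≤ x.2 then coeff (x.2 - y.2 : ℕ) (A x.1 y.1) else 0

variable {R : Type*} [CommRing R] {ι κ : Type*}

@[simp]
theorem jetCoeffs_apply (q : ℕ) (y : ι → R⟦X⟧) (x : ι × Fin q) :
    jetCoeffs R ι q y x = coeff (x.2 : ℕ) (y x.1) := rfl

theorem jetCoeffs_surjective (q : ℕ) : Function.Surjective (jetCoeffs R ι q) := by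
  intro v
  refine ⟨fun i => PowerSeries.mk fun c => if h : c < q then v (i, ⟨c, h⟩) else 0, ?_⟩
  ext ⟨i, c⟩
  simp

theorem jetCoeffs_eq_zero_iff {q : ℕ} {y : ι → R⟦X⟧} :
    jetCoeffs R ι q y = 0 ↔ ∃ z : ι → R⟦X⟧, y = (X : R⟦X⟧) ^ q • z := by
  constructor
  · intro h
    have : ∀ i, (X : R⟦X⟧) ^ q ∣ y i := fun i =>
      X_pow_dvd_iff.mpr fun c hc => congrFun h (i, ⟨c, hc⟩)
    choose z hz using this
    exact ⟨z, funext hz⟩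
  · rintro ⟨z, rfl⟩
    ext ⟨i, c⟩
    simp [coeff_X_pow_mul']

theorem map_toeplitz {S : Type*} [CommRing S] (g : R →+* S) (q : ℕ) (A : Matrix ι κ R⟦X⟧) :
    (toeplitz q A).map g = toeplitz q (A.map (PowerSeries.map g)) := by
  ext x y
  simp only [toeplitz, Matrix.map_apply, Matrix.of_apply, coeff_map]
  split_ifs <;> simp

theorem toeplitz_mulVec_jetCoeffs [Fintype κ] (q : ℕ) (A : Matrix ι κ R⟦X⟧) (w : κ → R⟦X⟧) :
    (toeplitz q A).mulVec (jetCoeffs R κ q w) = jetCoeffs R ι q (A.mulVec w) := by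
  ext ⟨i, c⟩
  simp only [Matrix.mulVec, dotProduct, jetCoeffs_apply, map_sum, toeplitz, Matrix.of_apply,
    Fintype.sum_prod_type]
  refine Finset.sum_congr rfl fun j _ => ?_
  rw [mul_comm (A i j), coeff_mul, Finset.Nat.sum_antidiagonal_eq_sum_range_succ
    (fun a b => coeff a (w j) * coeff b (A i j)),
    Fin.sum_univ_eq_sum_range (fun d => (if d ≤ (c : ℕ) then coeff (c - d : ℕ) (A i j) else 0) *
      coeff d (w j)) q]
  rw [← Finset.sum_subset (Finset.range_subset_range.mpr (Nat.succ_le_of_lt c.2))]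
  · refine Finset.sum_congr rfl fun d hd => ?_
    rw [if_pos (Nat.lt_succ_iff.mp (Finset.mem_range.mp hd)), mul_comm]
  · intro d _ hd
    rw [if_neg (by simpa using hd), zero_mul]

theorem range_toeplitz [Fintype κ] (q : ℕ) (A : Matrix ι κ R⟦X⟧) :
    LinearMap.range (toeplitz q A).mulVecLin =
      ((LinearMap.range A.mulVecLin).restrictScalars R).map (jetCoeffs R ι q) := by
  ext y
  constructor
  · rintro ⟨v, rfl⟩
    obtain ⟨w, rfl⟩ := jetCoeffs_surjective q v
    exact ⟨_, ⟨w, rfl⟩, (toeplitz_mulVec_jetCoeffs q A w).symm⟩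
  · rintro ⟨_, ⟨w, rfl⟩, rfl⟩
    exact ⟨jetCoeffs R κ q w, toeplitz_mulVec_jetCoeffs q A w⟩

/-- The column space of the truncation of `A` consists of the truncations of the vectors in the
column space of `A` modulo `X ^ q`. -/
theorem exists_toeplitz_mulVec_eq_iff [Fintype κ] (q : ℕ) (A : Matrix ι κ R⟦X⟧) (y : ι → R⟦X⟧) :
    (∃ v, (toeplitz q A).mulVec v = jetCoeffs R ι q y) ↔
      ∃ (w : κ → R⟦X⟧) (z : ι → R⟦X⟧), y = A.mulVec w + (X : R⟦X⟧) ^ q • z := by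
  constructor
  · rintro ⟨v, hv⟩
    obtain ⟨w, rfl⟩ := jetCoeffs_surjective q v
    rw [toeplitz_mulVec_jetCoeffs, ← sub_eq_zero, ← map_sub, jetCoeffs_eq_zero_iff] at hv
    obtain ⟨z, hz⟩ := hv
    exact ⟨w, -z, by rw [smul_neg, ← hz]; abel⟩
  · rintro ⟨w, z, rfl⟩
    refine ⟨jetCoeffs R κ q w, ?_⟩
    rw [toeplitz_mulVec_jetCoeffs, map_add, jetCoeffs_eq_zero_iff.mpr ⟨z, rfl⟩, add_zero]

end Toeplitz

/-! ### Ranks of truncated matrices -/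

section ToeplitzRank

open PowerSeries Module

variable {k : Type*} [Field k]

theorem finrank_map_add_finrank_inf_ker {V W : Type*} [AddCommGroup V] [Module k V]
    [FiniteDimensional k V] [AddCommGroup W] [Module k W] (f : V →ₗ[k] W) (P : Submodule k V) :
    finrank k (P.map f) + finrank k (P ⊓ LinearMap.ker f : Submodule k V) = finrank k P := by
  have h := LinearMap.finrank_range_add_finrank_ker (f.domRestrict P)
  rw [LinearMap.range_domRestrict] at h
  rw [← h, ← Submodule.map_comap_subtype, Submodule.finrank_map_subtype_eq]
  rfl

variable {ι κ : Type*} [Fintype κ]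

/-- Reversing the order of the coefficients turns the transpose of a Toeplitz matrix into the
Toeplitz matrix of the transpose. -/
theorem rank_toeplitz_transpose [Fintype ι] (q : ℕ) (A : Matrix ι κ k⟦X⟧) :
    (toeplitz q A.transpose).rank = (toeplitz q A).rank := by
  have : toeplitz q A.transpose = ((toeplitz q A).transpose).submatrix
      (Equiv.prodCongr (Equiv.refl κ) Fin.revPerm)
      (Equiv.prodCongr (Equiv.refl ι) Fin.revPerm) := by
    ext ⟨j, c⟩ ⟨i, d⟩
    have h1 : (q - (d + 1) - (q - (c + 1)) : ℕ) = c - d := by omega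
    simp [toeplitz, Fin.val_rev, h1]
  rw [this, Matrix.rank_submatrix, Matrix.rank_transpose]

/-- Multiplication by `X ^ j` identifies `k⟦X⟧ / X ^ q` with a submodule of `k⟦X⟧ / X ^ (q + j)`. -/
theorem rank_toeplitz_X_pow_smul (q j : ℕ) (A : Matrix ι κ k⟦X⟧) :
    (toeplitz (q + j) ((X : k⟦X⟧) ^ j • A)).rank = (toeplitz q A).rank := by
  let sh : (ι × Fin q → k) →ₗ[k] (ι × Fin (q + j) → k) :=
    { toFun := fun v x => if h : j ≤ x.2 then v (x.1, ⟨x.2 - j, by omega⟩) else 0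
      map_add' := fun v w => by ext x; by_cases h : j ≤ (x.2 : ℕ) <;> simp [h]
      map_smul' := fun c v => by ext x; by_cases h : j ≤ (x.2 : ℕ) <;> simp [h] }
  have hsh : Function.Injective sh := by
    intro v w hvw
    ext ⟨i, c⟩
    have := congrFun hvw (i, ⟨c + j, by omega⟩)
    simpa [sh] using this
  have hcomp : ∀ y : ι → k⟦X⟧,
      sh (jetCoeffs k ι q y) = jetCoeffs k ι (q + j) ((X : k⟦X⟧) ^ j • y) := by
    intro y
    ext ⟨i, c⟩
    simp [sh, coeff_X_pow_mul']
  have hrange : LinearMap.range (toeplitz (q + j) ((X : k⟦X⟧) ^ j • A)).mulVecLin =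
      (LinearMap.range (toeplitz q A).mulVecLin).map sh := by
    rw [range_toeplitz, range_toeplitz]
    ext v
    constructor
    · rintro ⟨_, ⟨w, rfl⟩, rfl⟩
      refine ⟨_, ⟨_, ⟨w, rfl⟩, rfl⟩, ?_⟩
      rw [hcomp, Matrix.mulVecLin_apply, Matrix.mulVecLin_apply, Matrix.smul_mulVec]
    · rintro ⟨_, ⟨_, ⟨w, rfl⟩, rfl⟩, rfl⟩
      refine ⟨_, ⟨w, rfl⟩, ?_⟩
      rw [hcomp, Matrix.mulVecLin_apply, Matrix.mulVecLin_apply, Matrix.smul_mulVec]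
  rw [Matrix.rank, hrange]
  exact (Submodule.equivMapOfInjective sh hsh _).finrank_eq.symm

/-- Forgetting the coefficient of order `q`. -/
def dropCoeff (k : Type*) [Field k] (ι : Type*) (q : ℕ) :
    (ι × Fin (q + 1) → k) →ₗ[k] (ι × Fin q → k) where
  toFun v x := v (x.1, x.2.castSucc)
  map_add' _ _ := rfl
  map_smul' _ _ := rfl

theorem dropCoeff_jetCoeffs (q : ℕ) (y : ι → k⟦X⟧) :
    dropCoeff k ι q (jetCoeffs k ι (q + 1) y) = jetCoeffs k ι q y := rfl

theorem finrank_ker_dropCoeff [Fintype ι] (q : ℕ) :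
    finrank k (LinearMap.ker (dropCoeff k ι q)) = Fintype.card ι := by
  have hs : Function.Surjective (dropCoeff k ι q) := by
    intro v
    obtain ⟨y, rfl⟩ := jetCoeffs_surjective q v
    exact ⟨_, dropCoeff_jetCoeffs q y⟩
  have h := LinearMap.finrank_range_add_finrank_ker (dropCoeff k ι q)
  rw [LinearMap.range_eq_top.mpr hs, finrank_top] at h
  simp only [finrank_fintype_fun_eq_card, Fintype.card_prod, Fintype.card_fin] at h
  rw [mul_add, mul_one] at h
  omega

theorem map_dropCoeff_range_toeplitz (q : ℕ) (A : Matrix ι κ k⟦X⟧) :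
    (LinearMap.range (toeplitz (q + 1) A).mulVecLin).map (dropCoeff k ι q) =
      LinearMap.range (toeplitz q A).mulVecLin := by
  rw [range_toeplitz, range_toeplitz, ← Submodule.map_comp]
  rfl

theorem rank_toeplitz_succ_le [Fintype ι] (q : ℕ) (A : Matrix ι κ k⟦X⟧) :
    (toeplitz (q + 1) A).rank ≤ (toeplitz q A).rank + Fintype.card ι := by
  have h := finrank_map_add_finrank_inf_ker (dropCoeff k ι q)
    (LinearMap.range (toeplitz (q + 1) A).mulVecLin)
  have h2 := Submodule.finrank_mono (inf_le_right :
    LinearMap.range (toeplitz (q + 1) A).mulVecLin ⊓ LinearMap.ker (dropCoeff k ι q) ≤ _)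
  rw [map_dropCoeff_range_toeplitz] at h
  rw [finrank_ker_dropCoeff] at h2
  unfold Matrix.rank
  omega

theorem span_X_le_jacobson : (Ideal.span {(X : k⟦X⟧)}) ≤ Ideal.jacobson ⊥ := by
  rw [IsLocalRing.jacobson_eq_maximalIdeal ⊥ bot_ne_top, ← maximalIdeal_eq_span_X]

/-- If the rank of the truncations of `A` grows by the number of rows from order `q` to order
`q + 1`, then every vector divisible by `X ^ q` is in the column space of `A`. -/
theorem X_pow_smul_mem_range [Fintype ι] (q : ℕ) (A : Matrix ι κ k⟦X⟧)
    (hA : (toeplitz q A).rank + Fintype.card ι ≤ (toeplitz (q + 1) A).rank) (y : ι → k⟦X⟧) :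
    (X : k⟦X⟧) ^ q • y ∈ LinearMap.range A.mulVecLin := by
  have h := finrank_map_add_finrank_inf_ker (dropCoeff k ι q)
    (LinearMap.range (toeplitz (q + 1) A).mulVecLin)
  rw [map_dropCoeff_range_toeplitz] at h
  have hker : LinearMap.range (toeplitz (q + 1) A).mulVecLin ⊓ LinearMap.ker (dropCoeff k ι q) =
      LinearMap.ker (dropCoeff k ι q) := by
    apply Submodule.eq_of_le_of_finrank_le inf_le_right
    rw [finrank_ker_dropCoeff]
    unfold Matrix.rank at hA
    omega
  let P : Submodule k⟦X⟧ (ι → k⟦X⟧) := LinearMap.range (LinearMap.lsmul k⟦X⟧ (ι → k⟦X⟧) (X ^ q))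
  have hP : P ≤ LinearMap.range A.mulVecLin := by
    apply Submodule.le_of_le_smul_of_le_jacobson_bot (I := Ideal.span {(X : k⟦X⟧)})
    · exact IsNoetherian.noetherian P
    · exact span_X_le_jacobson
    · rintro _ ⟨y, rfl⟩
      have hy : jetCoeffs k ι (q + 1) ((X : k⟦X⟧) ^ q • y) ∈ LinearMap.ker (dropCoeff k ι q) := by
        rw [LinearMap.mem_ker, dropCoeff_jetCoeffs]
        exact jetCoeffs_eq_zero_iff.mpr ⟨y, rfl⟩
      rw [← hker] at hy
      obtain ⟨w, z, hwz⟩ := (exists_toeplitz_mulVec_eq_iff (q + 1) A _).mp hy.1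
      rw [LinearMap.lsmul_apply, hwz]
      refine Submodule.add_mem_sup ⟨w, rfl⟩ ?_
      rw [pow_succ', mul_smul]
      exact Submodule.smul_mem_smul (Ideal.mem_span_singleton_self _) ⟨z, rfl⟩
  exact hP ⟨y, rfl⟩

/-- The column space of `A` only depends on `A` modulo `X ^ (q + 1)`, if it contains all vectors
divisible by `X ^ q`. -/
theorem range_mulVecLin_eq_of_congr [Finite ι] {q : ℕ} {A B C : Matrix ι κ k⟦X⟧}
    (hB : B = A + (X : k⟦X⟧) ^ (q + 1) • C)
    (hA : ∀ y : ι → k⟦X⟧, (X : k⟦X⟧) ^ q • y ∈ LinearMap.range A.mulVecLin) :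
    LinearMap.range B.mulVecLin = LinearMap.range A.mulVecLin := by
  have hmem : ∀ y : ι → k⟦X⟧, (X : k⟦X⟧) ^ (q + 1) • y ∈
      Ideal.span {(X : k⟦X⟧)} • LinearMap.range A.mulVecLin := by
    intro y
    rw [pow_succ', mul_smul]
    exact Submodule.smul_mem_smul (Ideal.mem_span_singleton_self _) (hA y)
  have hBw : ∀ w, B.mulVec w = A.mulVec w + (X : k⟦X⟧) ^ (q + 1) • C.mulVec w := by
    intro w
    rw [hB, Matrix.add_mulVec, Matrix.smul_mulVec]
  apply le_antisymm
  · rintro _ ⟨w, rfl⟩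
    rw [Matrix.mulVecLin_apply, hBw]
    exact add_mem ⟨w, rfl⟩ (Submodule.smul_le_right (hmem _))
  · apply Submodule.le_of_le_smul_of_le_jacobson_bot (I := Ideal.span {(X : k⟦X⟧)})
    · exact IsNoetherian.noetherian _
    · exact span_X_le_jacobson
    · rintro _ ⟨w, rfl⟩
      rw [Matrix.mulVecLin_apply, ← add_sub_cancel_right (A.mulVec w)
        ((X : k⟦X⟧) ^ (q + 1) • C.mulVec w), ← hBw, sub_eq_add_neg]
      exact Submodule.add_mem_sup ⟨w, rfl⟩ (neg_mem (hmem _))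

/-- The rank of a truncation measures the cokernel of `A` modulo `X ^ q`. -/
theorem finrank_quotient_add_rank_toeplitz [Fintype ι] (q : ℕ) (A : Matrix ι κ k⟦X⟧) :
    finrank k ((ι → k⟦X⟧) ⧸ (LinearMap.range A.mulVecLin ⊔
      LinearMap.range (LinearMap.lsmul k⟦X⟧ (ι → k⟦X⟧) (X ^ q)))) + (toeplitz q A).rank =
      Fintype.card ι * q := by
  let g : (ι → k⟦X⟧) →ₗ[k] (ι × Fin q → k) ⧸ LinearMap.range (toeplitz q A).mulVecLin :=
    (Submodule.mkQ _).comp (jetCoeffs k ι q)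
  have hg : Function.Surjective g := (Submodule.mkQ_surjective _).comp (jetCoeffs_surjective q)
  have hker : LinearMap.ker g = (LinearMap.range A.mulVecLin ⊔
      LinearMap.range (LinearMap.lsmul k⟦X⟧ (ι → k⟦X⟧) (X ^ q))).restrictScalars k := by
    ext y
    rw [LinearMap.mem_ker, Submodule.restrictScalars_mem, Submodule.mem_sup]
    change Submodule.mkQ _ (jetCoeffs k ι q y) = 0 ↔ _
    rw [Submodule.mkQ_apply, Submodule.Quotient.mk_eq_zero]
    refine (exists_toeplitz_mulVec_eq_iff q A y).trans ⟨?_, ?_⟩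
    · rintro ⟨w, z, rfl⟩
      exact ⟨_, ⟨w, rfl⟩, _, ⟨z, rfl⟩, rfl⟩
    · rintro ⟨_, ⟨w, rfl⟩, _, ⟨z, rfl⟩, rfl⟩
      exact ⟨w, z, rfl⟩
  have e1 := (g.quotKerEquivOfSurjective hg).finrank_eq
  rw [hker] at e1
  have e2 := Submodule.finrank_quotient_add_finrank (LinearMap.range (toeplitz q A).mulVecLin)
  rw [← e1, finrank_fintype_fun_eq_card, Fintype.card_prod, Fintype.card_fin] at e2
  rw [← e2, Matrix.rank]
  congr 1

end ToeplitzRank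

/-! ### Lifts of jets to power series -/

section Lift

open PowerSeries

variable {k : Type*} [Field k] {N m : ℕ}

/-- The polynomial lift of a jet, with coefficients in any ring `R`: the generic jet is the case
where `R` is a polynomial ring. -/
def jetLift {R : Type*} [CommRing R] {l : ℕ} (a : Fin N × Fin (l + 1) → R) (i : Fin N) : R⟦X⟧ :=
  ∑ j : Fin (l + 1), C (a (i, j)) * X ^ (j : ℕ)

theorem coeff_jetLift {R : Type*} [CommRing R] {l : ℕ} (a : Fin N × Fin (l + 1) → R) (i : Fin N)
    (c : ℕ) : coeff c (jetLift a i) = if h : c < l + 1 then a (i, ⟨c, h⟩) else 0 := by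
  simp only [jetLift, map_sum, coeff_C_mul, coeff_X_pow, mul_ite, mul_one, mul_zero]
  split_ifs with h
  · rw [Finset.sum_eq_single ⟨c, h⟩]
    · simp
    · intro j _ hj
      rw [if_neg]
      rintro rfl
      exact hj rfl
    · simp
  · refine Finset.sum_eq_zero fun j _ => ?_
    rw [if_neg]
    omega

/-- The values of `f_1, …, f_m` in the polynomial lift of a jet. -/
def liftVal (f : Fin m → MvPolynomial (Fin N) k) {R : Type*} [CommRing R] [Algebra k R] {l : ℕ}
    (a : Fin N × Fin (l + 1) → R) : Fin m → R⟦X⟧ :=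
  fun i => MvPolynomial.aeval (jetLift a) (f i)

/-- The Jacobian matrix of `f_1, …, f_m` in the polynomial lift of a jet. -/
def liftJac (f : Fin m → MvPolynomial (Fin N) k) {R : Type*} [CommRing R] [Algebra k R] {l : ℕ}
    (a : Fin N × Fin (l + 1) → R) : Matrix (Fin m) (Fin N) R⟦X⟧ :=
  Matrix.of fun i j => MvPolynomial.aeval (jetLift a) (MvPolynomial.pderiv j (f i))

/-- The coefficients of the value of a polynomial in the lift of a jet are polynomials in the
coordinates of the jet: they specialise from a jet `b` over a polynomial ring. -/
theorem map_eval_aeval_jetLift {σ : Type*} {l : ℕ} (a : σ → k)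
    (b : Fin N × Fin (l + 1) → MvPolynomial σ k) (p : MvPolynomial (Fin N) k) :
    PowerSeries.map (MvPolynomial.eval a) (MvPolynomial.aeval (jetLift b) p) =
      MvPolynomial.aeval (jetLift fun ij => MvPolynomial.eval a (b ij)) p := by
  induction p using MvPolynomial.induction_on with
  | C c =>
    rw [MvPolynomial.aeval_C, MvPolynomial.aeval_C, PowerSeries.algebraMap_apply,
      PowerSeries.algebraMap_apply, map_C]
    simp
  | add p q hp hq => rw [map_add, map_add, hp, hq, map_add]
  | mul_X p i hp =>
    rw [map_mul, map_mul, hp, map_mul, MvPolynomial.aeval_X, MvPolynomial.aeval_X]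
    simp [jetLift]

theorem map_eval_liftVal (f : Fin m → MvPolynomial (Fin N) k) {σ : Type*} {l : ℕ} (a : σ → k)
    (b : Fin N × Fin (l + 1) → MvPolynomial σ k) (i : Fin m) :
    PowerSeries.map (MvPolynomial.eval a) (liftVal f b i) =
      liftVal f (fun ij => MvPolynomial.eval a (b ij)) i :=
  map_eval_aeval_jetLift a b (f i)

theorem map_eval_liftJac (f : Fin m → MvPolynomial (Fin N) k) {σ : Type*} {l : ℕ} (a : σ → k)
    (b : Fin N × Fin (l + 1) → MvPolynomial σ k) :
    (liftJac f b).map (PowerSeries.map (MvPolynomial.eval a)) =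
      liftJac f fun ij => MvPolynomial.eval a (b ij) := by
  ext1 i j
  exact map_eval_aeval_jetLift a b _

/-- The value of a polynomial in a jet is the reduction of its value in the polynomial lift. -/
theorem aeval_jetSeries {n : ℕ} (a : AffineJet k N n) (p : MvPolynomial (Fin N) k) :
    MvPolynomial.aeval (jetSeries a) p =
      Ideal.Quotient.mk _ (MvPolynomial.aeval (jetLift a) p) := by
  have : (MvPolynomial.aeval (jetSeries a) : MvPolynomial (Fin N) k →ₐ[k] _) =
      (Ideal.Quotient.mkₐ k _).comp (MvPolynomial.aeval (jetLift a)) := by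
    apply MvPolynomial.algHom_ext
    intro i
    rw [AlgHom.comp_apply, MvPolynomial.aeval_X, MvPolynomial.aeval_X]
    rfl
  rw [this]
  rfl

theorem mem_jets_iff (f : Fin m → MvPolynomial (Fin N) k) {n : ℕ} (a : AffineJet k N n) :
    a ∈ jets (Ideal.span (Set.range f)) n ↔
      ∃ z : Fin m → k⟦X⟧, liftVal f a = (X : k⟦X⟧) ^ (n + 1) • z := by
  have h1 : a ∈ jets (Ideal.span (Set.range f)) n ↔ ∀ i, (X : k⟦X⟧) ^ (n + 1) ∣ liftVal f a i := by
    constructor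
    · intro h i
      have := h (f i) (Ideal.subset_span ⟨i, rfl⟩)
      rwa [aeval_jetSeries, Ideal.Quotient.eq_zero_iff_mem, Ideal.mem_span_singleton] at this
    · intro h
      change Ideal.span (Set.range f) ≤
        RingHom.ker (MvPolynomial.aeval (jetSeries a) : MvPolynomial (Fin N) k →ₐ[k] _).toRingHom
      rw [Ideal.span_le]
      rintro _ ⟨i, rfl⟩
      rw [SetLike.mem_coe, RingHom.mem_ker]
      change MvPolynomial.aeval (jetSeries a) (f i) = 0
      rw [aeval_jetSeries, Ideal.Quotient.eq_zero_iff_mem, Ideal.mem_span_singleton]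
      exact h i
  rw [h1]
  constructor
  · intro h
    choose z hz using h
    exact ⟨z, funext hz⟩
  · rintro ⟨z, hz⟩ i
    exact ⟨z i, congrFun hz i⟩

end Lift

/-! ### The invariants of the Jacobian matrix and the ranks of its truncations -/

section Invariants

open PowerSeries Module

variable {k : Type*} [Field k] {N m : ℕ}

theorem ker_mkQ_comp_of_surjective {V M : Type*} [AddCommGroup V] [Module k⟦X⟧ V] [AddCommGroup M]
    [Module k⟦X⟧ M] (π : V →ₗ[k⟦X⟧] M) (hπ : Function.Surjective π) (r : k⟦X⟧) :
    LinearMap.ker ((LinearMap.range (LinearMap.lsmul k⟦X⟧ M r)).mkQ.comp π) =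
      LinearMap.ker π ⊔ LinearMap.range (LinearMap.lsmul k⟦X⟧ V r) := by
  have : LinearMap.range (LinearMap.lsmul k⟦X⟧ M r) =
      (LinearMap.range (LinearMap.lsmul k⟦X⟧ V r)).map π := by
    ext y
    constructor
    · rintro ⟨z, rfl⟩
      obtain ⟨v, rfl⟩ := hπ z
      exact ⟨_, ⟨v, rfl⟩, map_smul _ _ _⟩
    · rintro ⟨_, ⟨v, rfl⟩, rfl⟩
      exact ⟨π v, (map_smul π r v).symm⟩
  rw [LinearMap.ker_comp, Submodule.ker_mkQ, this, Submodule.comap_map_eq, sup_comm]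

/-- The presentation of the module of a jet by `k⟦X⟧ ^ N`. -/
def jacPresentation (f : Fin m → MvPolynomial (Fin N) k) {n : ℕ} (a : AffineJet k N n) :
    (Fin N → k⟦X⟧) →ₗ[k⟦X⟧] JacModule f a :=
  (Submodule.mkQ _).comp (LinearMap.pi fun i =>
    (Submodule.mkQ (Ideal.span {(X : k⟦X⟧) ^ (n + 1)})).comp (LinearMap.proj i))

theorem jacPresentation_surjective (f : Fin m → MvPolynomial (Fin N) k) {n : ℕ}
    (a : AffineJet k N n) : Function.Surjective (jacPresentation f a) := by
  refine (Submodule.mkQ_surjective _).comp fun y => ?_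
  choose z hz using fun i => Submodule.mkQ_surjective _ (y i)
  exact ⟨z, funext hz⟩

theorem ker_jacPresentation (f : Fin m → MvPolynomial (Fin N) k) {n : ℕ} (a : AffineJet k N n) :
    LinearMap.ker (jacPresentation f a) = LinearMap.range (liftJac f a).transpose.mulVecLin ⊔
      LinearMap.range (LinearMap.lsmul k⟦X⟧ (Fin N → k⟦X⟧) (X ^ (n + 1))) := by
  let P : (Fin N → k⟦X⟧) →ₗ[k⟦X⟧] (Fin N → TruncSeries k (n + 1)) := LinearMap.pi fun i =>
    (Submodule.mkQ (Ideal.span {(X : k⟦X⟧) ^ (n + 1)})).comp (LinearMap.proj i)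
  have h1 : Submodule.span k⟦X⟧ (Set.range fun i => jacobian f a i) =
      (LinearMap.range (liftJac f a).transpose.mulVecLin).map P := by
    rw [Matrix.range_mulVecLin, Submodule.map_span, ← Set.range_comp]
    congr 2
    ext i j
    exact aeval_jetSeries a _
  have h2 : LinearMap.ker P =
      LinearMap.range (LinearMap.lsmul k⟦X⟧ (Fin N → k⟦X⟧) (X ^ (n + 1))) := by
    ext y
    have : y ∈ LinearMap.ker P ↔ ∀ i, (X : k⟦X⟧) ^ (n + 1) ∣ y i := by
      rw [LinearMap.mem_ker, funext_iff]
      refine forall_congr' fun i => ?_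
      rw [← Ideal.mem_span_singleton]
      exact Submodule.Quotient.mk_eq_zero _
    rw [this]
    constructor
    · intro h
      choose z hz using h
      exact ⟨z, (funext hz).symm⟩
    · rintro ⟨z, rfl⟩ i
      exact ⟨z i, rfl⟩
  change LinearMap.ker ((Submodule.mkQ _).comp P) = _
  rw [LinearMap.ker_comp, Submodule.ker_mkQ, h1, Submodule.comap_map_eq, h2]

theorem finrank_quotient_pi_span_X_pow (d : Fin N → ℕ) {K : Submodule k⟦X⟧ (Fin N → k⟦X⟧)}
    (hK : ∀ y, y ∈ K ↔ ∀ i, (X : k⟦X⟧) ^ d i ∣ y i) :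
    finrank k ((Fin N → k⟦X⟧) ⧸ K) = ∑ i, d i := by
  let g : (Fin N → k⟦X⟧) →ₗ[k] ((Σ i, Fin (d i)) → k) :=
    { toFun := fun y x => coeff (x.2 : ℕ) (y x.1)
      map_add' := fun y z => by ext; simp
      map_smul' := fun c y => by ext; simp }
  have hg : Function.Surjective g := by
    intro v
    refine ⟨fun i => PowerSeries.mk fun c => if h : c < d i then v ⟨i, ⟨c, h⟩⟩ else 0, ?_⟩
    ext ⟨i, c⟩
    simp [g]
  have hker : LinearMap.ker g = K.restrictScalars k := by
    ext y
    rw [LinearMap.mem_ker, Submodule.restrictScalars_mem, hK]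
    constructor
    · exact fun h i => X_pow_dvd_iff.mpr fun c hc => congrFun h ⟨i, ⟨c, hc⟩⟩
    · exact fun h => funext fun x => X_pow_dvd_iff.mp (h x.1) x.2 x.2.2
  have e := (g.quotKerEquivOfSurjective hg).finrank_eq
  rw [hker, finrank_fintype_fun_eq_card, Fintype.card_sigma] at e
  simp only [Fintype.card_fin] at e
  exact e

/-- The invariants determine the ranks of all truncations of the Jacobian matrix. -/
theorem IsInvariantSeq.rank_toeplitz {f : Fin m → MvPolynomial (Fin N) k} {n : ℕ}
    {a : AffineJet k N n} {ε : Fin N → ℕ} (hε : IsInvariantSeq f a ε) {i : ℕ} (hi : i ≤ n + 1) :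
    (toeplitz i (liftJac f a)).rank = ∑ j, (i - ε j) := by
  obtain ⟨-, -, ⟨φ⟩⟩ := hε
  let π : (Fin N → k⟦X⟧) →ₗ[k⟦X⟧] ((j : Fin N) → TruncSeries k (ε j)) := LinearMap.pi fun j =>
    (Submodule.mkQ (Ideal.span {(X : k⟦X⟧) ^ ε j})).comp (LinearMap.proj j)
  have hπ : Function.Surjective π := by
    intro y
    choose z hz using fun i => Submodule.mkQ_surjective _ (y i)
    exact ⟨z, funext hz⟩
  let ψ := φ.toLinearMap.comp (jacPresentation f a)
  have hψ : Function.Surjective ψ := φ.surjective.comp (jacPresentation_surjective f a)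
  have h1 := ker_mkQ_comp_of_surjective π hπ (X ^ i)
  have h2 := ker_mkQ_comp_of_surjective ψ hψ (X ^ i)
  have hkψ : LinearMap.ker ψ ⊔ LinearMap.range (LinearMap.lsmul k⟦X⟧ (Fin N → k⟦X⟧) (X ^ i)) =
      LinearMap.range (liftJac f a).transpose.mulVecLin ⊔
        LinearMap.range (LinearMap.lsmul k⟦X⟧ (Fin N → k⟦X⟧) (X ^ i)) := by
    rw [LinearMap.ker_comp_of_ker_eq_bot _ (LinearEquiv.ker φ), ker_jacPresentation, sup_assoc]
    congr 1
    rw [sup_eq_right]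
    rintro _ ⟨y, rfl⟩
    refine ⟨(X : k⟦X⟧) ^ (n + 1 - i) • y, ?_⟩
    rw [LinearMap.lsmul_apply, LinearMap.lsmul_apply, smul_smul, ← pow_add]
    congr 2
    omega
  have hkπ : ∀ y, y ∈ LinearMap.ker π ⊔
      LinearMap.range (LinearMap.lsmul k⟦X⟧ (Fin N → k⟦X⟧) (X ^ i)) ↔
      ∀ j, (X : k⟦X⟧) ^ min (ε j) i ∣ y j := by
    have hker : ∀ y, y ∈ LinearMap.ker π ↔ ∀ j, (X : k⟦X⟧) ^ ε j ∣ y j := by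
      intro y
      rw [LinearMap.mem_ker, funext_iff]
      refine forall_congr' fun i => ?_
      rw [← Ideal.mem_span_singleton]
      exact Submodule.Quotient.mk_eq_zero _
    intro y
    rw [Submodule.mem_sup]
    constructor
    · rintro ⟨z, hz, _, ⟨w, rfl⟩, rfl⟩ j
      exact dvd_add ((pow_dvd_pow _ (min_le_left _ _)).trans ((hker z).mp hz j))
        ((pow_dvd_pow _ (min_le_right _ _)).trans ⟨w j, rfl⟩)
    · intro h
      choose z hz using h
      refine ⟨fun j => if ε j ≤ i then y j else 0, (hker _).mpr fun j => ?_, _,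
        ⟨fun j => if ε j ≤ i then 0 else z j, rfl⟩, ?_⟩
      · split_ifs with hj
        · rw [hz j, min_eq_left hj]
          exact dvd_mul_right _ _
        · exact dvd_zero _
      · ext1 j
        by_cases hj : ε j ≤ i
        · simp [hj]
        · simp only [Pi.add_apply, LinearMap.lsmul_apply, Pi.smul_apply, if_neg hj, zero_add,
            smul_eq_mul]
          rw [hz j, min_eq_right (by omega)]
  have e1 := LinearMap.quotKerEquivOfSurjective
    ((LinearMap.range (LinearMap.lsmul k⟦X⟧ _ (X ^ i))).mkQ.comp π)
    ((Submodule.mkQ_surjective _).comp hπ)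
  have e2 := LinearMap.quotKerEquivOfSurjective
    ((LinearMap.range (LinearMap.lsmul k⟦X⟧ _ (X ^ i))).mkQ.comp ψ)
    ((Submodule.mkQ_surjective _).comp hψ)
  have e := ((Submodule.quotEquivOfEq _ _ (h2.trans hkψ)).symm.trans (e2.trans e1.symm)).trans
    (Submodule.quotEquivOfEq _ _ h1)
  have hfin := (e.restrictScalars k).finrank_eq
  rw [finrank_quotient_pi_span_X_pow _ hkπ] at hfin
  have hrank := finrank_quotient_add_rank_toeplitz i (liftJac f a).transpose
  rw [rank_toeplitz_transpose, hfin, Fintype.card_fin] at hrank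
  have hsum : ∑ j, min (ε j) i + ∑ j, (i - ε j) = N * i := by
    rw [← Finset.sum_add_distrib, Finset.sum_congr rfl (g := fun _ => i) (fun j _ => by omega)]
    simp
  omega

/-- Existence of the invariants, by the Smith normal form over the principal ideal domain `k⟦X⟧`. -/
theorem exists_isInvariantSeq (f : Fin m → MvPolynomial (Fin N) k) {n : ℕ} (a : AffineJet k N n) :
    ∃ ε, IsInvariantSeq f a ε := by
  let W := LinearMap.ker (jacPresentation f a)
  have hW : ∀ y : Fin N → k⟦X⟧, (X : k⟦X⟧) ^ (n + 1) • y ∈ W := by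
    intro y
    simp only [W, ker_jacPresentation]
    exact Submodule.mem_sup_right ⟨y, rfl⟩
  have hrank : finrank k⟦X⟧ W = finrank k⟦X⟧ (Fin N → k⟦X⟧) := by
    apply le_antisymm (Submodule.finrank_le W)
    rw [← LinearMap.finrank_range_of_inj
      (f := LinearMap.lsmul k⟦X⟧ (Fin N → k⟦X⟧) (X ^ (n + 1)))
      (smul_right_injective _ (pow_ne_zero _ X_ne_zero))]
    apply Submodule.finrank_mono
    rintro _ ⟨y, rfl⟩
    exact hW y
  let b := Pi.basisFun k⟦X⟧ (Fin N)
  let c := Submodule.smithNormalFormCoeffs b hrank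
  let E : ((Fin N → k⟦X⟧) ⧸ W) ≃ₗ[k⟦X⟧] ((i : Fin N) → k⟦X⟧ ⧸ Ideal.span {c i}) :=
    W.quotientEquivPiSpan b hrank
  have hc : ∀ i, (X : k⟦X⟧) ^ (n + 1) ∈ Ideal.span {c i} := by
    intro i
    obtain ⟨y, hy⟩ := (E.surjective.comp W.mkQ_surjective)
      (Pi.single i (1 : k⟦X⟧ ⧸ Ideal.span {c i}))
    have h0 : E (W.mkQ ((X : k⟦X⟧) ^ (n + 1) • y)) = 0 := by
      rw [Submodule.mkQ_apply, (Submodule.Quotient.mk_eq_zero W).mpr (hW y), map_zero]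
    rw [map_smul, map_smul] at h0
    have h1 := congrFun h0 i
    rw [show E (W.mkQ y) = _ from hy, Pi.smul_apply, Pi.single_eq_same] at h1
    have h2 : Ideal.Quotient.mk (Ideal.span {c i}) ((X : k⟦X⟧) ^ (n + 1) * 1) = 0 := h1
    rwa [mul_one, Ideal.Quotient.eq_zero_iff_mem] at h2
  have hpow : ∀ i, ∃ d, Ideal.span {c i} = Ideal.span {(X : k⟦X⟧) ^ d} := by
    intro i
    apply IsDiscreteValuationRing.ideal_eq_span_pow_irreducible _ X_irreducible
    intro hbot
    have := hc i
    rw [hbot, Ideal.mem_bot] at this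
    exact pow_ne_zero _ X_ne_zero this
  choose d hd using hpow
  have hdn : ∀ i, d i ≤ n + 1 := by
    intro i
    have := hc i
    rw [hd, Ideal.mem_span_singleton] at this
    exact (pow_dvd_pow_iff X_ne_zero X_irreducible.not_isUnit).mp this
  let σ := Tuple.sort d
  refine ⟨d ∘ σ, Tuple.monotone_sort d, fun i => hdn _, ⟨?_⟩⟩
  let E₀ := (jacPresentation f a).quotKerEquivOfSurjective (jacPresentation_surjective f a)
  let E' : ((i : Fin N) → k⟦X⟧ ⧸ Ideal.span {c i}) ≃ₗ[k⟦X⟧] ((i : Fin N) → TruncSeries k (d i)) :=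
    LinearEquiv.piCongrRight fun i => (Ideal.quotientEquivAlgOfEq k⟦X⟧ (hd i)).toLinearEquiv
  let E'' := (LinearEquiv.piCongrLeft k⟦X⟧ (fun i => TruncSeries k (d i)) σ).symm
  exact E₀.symm.trans (E.trans (E'.trans E''))

/-- A sequence in increasing order is determined by the sums of the truncated differences
`i - ε j`. -/
theorem eq_of_sum_sub_eq {n : ℕ} {ε δ : Fin N → ℕ} (hε : Monotone ε) (hδ : Monotone δ)
    (hεn : ∀ j, ε j ≤ n + 1) (hδn : ∀ j, δ j ≤ n + 1)
    (h : ∀ i ≤ n + 1, ∑ j, (i - ε j) = ∑ j, (i - δ j)) : ε = δ := by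
  have hstep : ∀ (γ : Fin N → ℕ) i, ∑ j, (i + 1 - γ j) =
      ∑ j, (i - γ j) + (Finset.univ.filter fun j => γ j ≤ i).card := by
    intro γ i
    rw [Finset.card_filter, ← Finset.sum_add_distrib]
    refine Finset.sum_congr rfl fun j _ => ?_
    split_ifs <;> omega
  -- in an increasing sequence, the entries `≤ i` are the first ones, so their number locates them
  have hlt : ∀ γ : Fin N → ℕ, Monotone γ → ∀ i j,
      γ j ≤ i ↔ (j : ℕ) < (Finset.univ.filter fun j => γ j ≤ i).card := by
    intro γ hγ i j
    constructor
    · intro hj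
      have : Finset.Iic j ⊆ Finset.univ.filter fun j => γ j ≤ i := by
        intro b hb
        simpa using (hγ (Finset.mem_Iic.mp hb)).trans hj
      have := Finset.card_le_card this
      rw [Fin.card_Iic] at this
      omega
    · intro hj
      by_contra hcon
      have : (Finset.univ.filter fun j => γ j ≤ i) ⊆ Finset.Iio j := by
        intro b hb
        rw [Finset.mem_Iio]
        by_contra hb'
        have := hγ (not_lt.mp hb')
        simp only [Finset.mem_filter, Finset.mem_univ, true_and] at hb
        omega
      have := Finset.card_le_card this
      rw [Fin.card_Iio] at this
      omega
  have hiff : ∀ j, ∀ i ≤ n, (ε j ≤ i ↔ δ j ≤ i) := by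
    intro j i hi
    have h1 := h (i + 1) (by omega)
    rw [hstep, hstep, h i (by omega)] at h1
    rw [hlt ε hε, hlt δ hδ, Nat.add_left_cancel h1]
  ext j
  apply le_antisymm
  · by_cases hj : δ j ≤ n
    · exact (hiff j _ hj).mpr le_rfl
    · have := hεn j
      omega
  · by_cases hj : ε j ≤ n
    · exact (hiff j _ hj).mp le_rfl
    · have := hδn j
      omega

/-- The rank of the truncation at order `i` of a matrix with invariants `e 1, …, e m`. -/
def expectedRank (m : ℕ) (e : ℕ → ℕ) (i : ℕ) : ℕ := ∑ j ∈ Finset.Icc 1 m, (i - e j)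

/-- The truncations of `A` up to order `n + 1` have the ranks prescribed by the invariants
`e 1, …, e m`. -/
def HasInvariants (n : ℕ) (e : ℕ → ℕ) (A : Matrix (Fin m) (Fin N) k⟦X⟧) : Prop :=
  ∀ i ≤ n + 1, (toeplitz i A).rank = expectedRank m e i

/-- The sequence `e 1, …, e m, n + 1, …, n + 1` of length `N` has the expected ranks: the entries
`n + 1` do not contribute up to order `n + 1`. -/
theorem sum_fin_extend (hmN : m ≤ N) {n : ℕ} (e : ℕ → ℕ) {i : ℕ} (hi : i ≤ n + 1) :
    ∑ j : Fin N, (i - if (j : ℕ) < m then e (j + 1) else n + 1) = expectedRank m e i := by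
  rw [Fin.sum_univ_eq_sum_range (fun j => i - if j < m then e (j + 1) else n + 1),
    ← Finset.sum_subset (Finset.range_subset_range.mpr hmN)]
  · rw [expectedRank, Finset.range_eq_Ico, ← Finset.Ico_add_one_right_eq_Icc,
      ← Finset.sum_Ico_add' (fun j => i - e j) 0 m 1]
    refine Finset.sum_congr rfl fun j hj => ?_
    rw [if_pos (Finset.mem_Ico.mp hj).2]
  · intro j _ hj
    rw [if_neg (by simpa using hj)]
    omega

/-- Membership in the stratum in terms of ranks. The condition `e_{m + 1} ≥ g` holds automatically,
as the Jacobian matrix only has `m` rows. -/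
theorem mem_jetStratum_iff (hmN : m ≤ N) (f : Fin m → MvPolynomial (Fin N) k)
    (I : Ideal (MvPolynomial (Fin N) k)) {n : ℕ} {e : ℕ → ℕ}
    (hmono : ∀ i j, 1 ≤ i → i ≤ j → j ≤ m → e i ≤ e j)
    (hen : ∀ i, 1 ≤ i → i ≤ m → e i ≤ n) (a : AffineJet k N n) :
    a ∈ jetStratum I f n m e ↔ a ∈ jets I n ∧ HasInvariants n e (liftJac f a) := by
  let δ : Fin N → ℕ := fun j => if (j : ℕ) < m then e (j + 1) else n + 1
  have hδ : Monotone δ := by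
    intro i j hij
    have hij' : (i : ℕ) ≤ j := hij
    simp only [δ]
    split_ifs with h1 h2 h2
    · exact hmono _ _ (by omega) (by omega) (by omega)
    · exact (hen _ (by omega) (by omega)).trans (by omega)
    · omega
    · omega
  have hδn : ∀ j, δ j ≤ n + 1 := by
    intro j
    simp only [δ]
    split_ifs with h
    · exact (hen _ (by omega) (by omega)).trans (by omega)
    · exact le_rfl
  refine and_congr_right fun _ => ?_
  constructor
  · rintro ⟨ε, hε, h1, -⟩
    -- the span of the `m` rows has at most `m` generators, so only `m` invariants are `≤ n`
    have hεδ : ε = δ := by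
      ext j
      simp only [δ]
      split_ifs with hj
      · exact h1 j hj
      · by_contra hne
        have hlt : ε j ≤ n := by
          have := hε.2.1 j
          omega
        have hr := rank_toeplitz_succ_le n (liftJac f a)
        rw [hε.rank_toeplitz le_rfl, hε.rank_toeplitz (by omega), Fintype.card_fin] at hr
        have hcard : (Finset.Iic j).card ≤ m := by
          have h2 : ∑ i, (n - ε i) + ∑ i, (if i ∈ Finset.Iic j then 1 else 0) ≤
              ∑ i, (n + 1 - ε i) := by
            rw [← Finset.sum_add_distrib]
            refine Finset.sum_le_sum fun i _ => ?_
            split_ifs with hi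
            · have := hε.1 (Finset.mem_Iic.mp hi)
              omega
            · omega
          simp only [Finset.sum_boole, Finset.filter_univ_mem, Nat.cast_id] at h2
          omega
        rw [Fin.card_Iic] at hcard
        omega
    intro i hi
    rw [hε.rank_toeplitz hi, hεδ]
    exact sum_fin_extend hmN e hi
  · intro h
    obtain ⟨ε, hε⟩ := exists_isInvariantSeq f a
    have hεδ : ε = δ := eq_of_sum_sub_eq hε.1 hδ hε.2.1 hδn fun i hi => by
      rw [← hε.rank_toeplitz hi, h i hi]
      exact (sum_fin_extend hmN e hi).symm
    refine ⟨ε, hε, fun i hi => ?_, fun i hi => ?_⟩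
    · simp [hεδ, δ, hi]
    · simp only [hεδ, δ, hi, lt_irrefl, if_false, halfUp]
      split_ifs <;> omega

end Invariants

/-! ### Lifting jets along truncation maps -/

section Taylor

/-- Taylor's formula to first order, valid in all characteristics. -/
theorem exists_taylor {k A σ : Type*} [Field k] [CommRing A] [Algebra k A] [Fintype σ]
    (x u : σ → A) (t : A) (p : MvPolynomial σ k) :
    ∃ r, MvPolynomial.aeval (fun i => x i + t * u i) p = MvPolynomial.aeval x p +
      t * ∑ j, MvPolynomial.aeval x (MvPolynomial.pderiv j p) * u j + t ^ 2 * r := by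
  classical
  induction p using MvPolynomial.induction_on with
  | C c => exact ⟨0, by simp⟩
  | add p q hp hq =>
    obtain ⟨r, hr⟩ := hp
    obtain ⟨s, hs⟩ := hq
    refine ⟨r + s, ?_⟩
    simp only [map_add, hr, hs, add_mul, Finset.sum_add_distrib]
    ring
  | mul_X p i hp =>
    obtain ⟨r, hr⟩ := hp
    have hsum : ∑ j, MvPolynomial.aeval x (MvPolynomial.pderiv j (p * MvPolynomial.X i)) * u j =
        x i * ∑ j, MvPolynomial.aeval x (MvPolynomial.pderiv j p) * u j +
          MvPolynomial.aeval x p * u i := by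
      have : ∀ j, MvPolynomial.aeval x (MvPolynomial.pderiv j (p * MvPolynomial.X i)) * u j =
          x i * (MvPolynomial.aeval x (MvPolynomial.pderiv j p) * u j) +
            if j = i then MvPolynomial.aeval x p * u j else 0 := by
        intro j
        rw [MvPolynomial.pderiv_mul, MvPolynomial.pderiv_X]
        by_cases h : j = i
        · subst h
          simp
          ring
        · simp [h, Ne.symm h]
          ring
      simp only [this, Finset.sum_add_distrib, ← Finset.mul_sum, Finset.sum_ite_eq',
        Finset.mem_univ, if_true]
    refine ⟨r * (x i + t * u i) +
      (∑ j, MvPolynomial.aeval x (MvPolynomial.pderiv j p) * u j) * u i, ?_⟩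
    rw [map_mul, map_mul, hr, hsum, MvPolynomial.aeval_X, MvPolynomial.aeval_X]
    ring

end Taylor

section Model

open PowerSeries Module

variable {k : Type*} [Field k] {N m : ℕ}

theorem trunc_trunc {n l l' : ℕ} (h : l ≤ l') (a : AffineJet k N n) :
    trunc l (trunc l' a) = trunc l a := by
  ext ⟨i, j⟩
  have := j.2
  simp only [trunc]
  rw [dif_pos (by omega)]

theorem trunc_self {n : ℕ} (a : AffineJet k N n) : trunc n a = a := by
  ext ⟨i, j⟩
  exact dif_pos j.2

theorem coeff_jetLift_trunc {n l : ℕ} (a : AffineJet k N n) (i : Fin N) {c : ℕ} (hc : c < l + 1) :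
    coeff c (jetLift (trunc l a) i) = coeff c (jetLift a i) := by
  rw [coeff_jetLift, coeff_jetLift, dif_pos hc]
  rfl

theorem exists_jetLift_eq_add {n l : ℕ} (a : AffineJet k N n) :
    ∃ u : Fin N → k⟦X⟧,
      jetLift a = fun i => jetLift (trunc l a) i + (X : k⟦X⟧) ^ (l + 1) * u i := by
  have : ∀ i, (X : k⟦X⟧) ^ (l + 1) ∣ jetLift a i - jetLift (trunc l a) i := by
    intro i
    rw [X_pow_dvd_iff]
    intro c hc
    rw [map_sub, coeff_jetLift_trunc a i hc, sub_self]
  choose u hu using this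
  exact ⟨u, funext fun i => by rw [← hu]; ring⟩

/-- The last coefficients of a jet. -/
def topCoeff {k : Type*} {l : ℕ} (a : AffineJet k N (l + 1)) (i : Fin N) : k :=
  a (i, Fin.last (l + 1))

theorem jetLift_eq_add_topCoeff {l : ℕ} (a : AffineJet k N (l + 1)) :
    jetLift a = fun i => jetLift (trunc l a) i + (X : k⟦X⟧) ^ (l + 1) * C (topCoeff a i) := by
  ext i c
  rw [map_add, coeff_jetLift, coeff_jetLift, mul_comm, coeff_C_mul, coeff_X_pow]
  rcases lt_trichotomy c (l + 1) with h | h | h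
  · rw [dif_pos (by omega), dif_pos h, if_neg (by omega)]
    simp [trunc, h.trans (Nat.lt_succ_self _)]
  · subst h
    simp [topCoeff, Fin.last]
  · rw [dif_neg (by omega), dif_neg (by omega), if_neg (by omega)]
    simp

/-- The jet with truncation `a` and last coefficients `v`. -/
def jetSnoc {k : Type*} {l : ℕ} (a : AffineJet k N l) (v : Fin N → k) : AffineJet k N (l + 1) :=
  fun ij => if h : (ij.2 : ℕ) < l + 1 then a (ij.1, ⟨ij.2, h⟩) else v ij.1

theorem trunc_jetSnoc {l : ℕ} (a : AffineJet k N l) (v : Fin N → k) :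
    trunc l (jetSnoc a v) = a := by
  ext ⟨i, j⟩
  have := j.2
  simp [trunc, jetSnoc]
  omega

theorem topCoeff_jetSnoc {k : Type*} {l : ℕ} (a : AffineJet k N l) (v : Fin N → k) :
    topCoeff (jetSnoc a v) = v := by
  ext i
  simp [topCoeff, jetSnoc]

theorem exists_liftJac_eq_add (f : Fin m → MvPolynomial (Fin N) k) {n l : ℕ}
    (a : AffineJet k N n) : ∃ D : Matrix (Fin m) (Fin N) k⟦X⟧,
      liftJac f a = liftJac f (trunc l a) + (X : k⟦X⟧) ^ (l + 1) • D := by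
  obtain ⟨u, hu⟩ := exists_jetLift_eq_add (l := l) a
  choose r hr using fun i j => exists_taylor (jetLift (trunc l a)) u ((X : k⟦X⟧) ^ (l + 1))
    (MvPolynomial.pderiv j (f i))
  refine ⟨Matrix.of fun i j => ∑ j', MvPolynomial.aeval (jetLift (trunc l a))
    (MvPolynomial.pderiv j' (MvPolynomial.pderiv j (f i))) * u j' + X ^ (l + 1) * r i j, ?_⟩
  ext1 i j
  simp only [liftJac, Matrix.of_apply, Matrix.add_apply, Matrix.smul_apply, smul_eq_mul, hu, hr]
  ring

theorem exists_liftVal_eq_add (f : Fin m → MvPolynomial (Fin N) k) {l : ℕ}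
    (a : AffineJet k N (l + 1)) : ∃ r : Fin m → k⟦X⟧,
      liftVal f a = liftVal f (trunc l a) + (X : k⟦X⟧) ^ (l + 1) •
        (liftJac f (trunc l a)).mulVec (fun i => C (topCoeff a i)) +
        (X : k⟦X⟧) ^ (2 * (l + 1)) • r := by
  choose r hr using fun i => exists_taylor (jetLift (trunc l a)) (fun i => C (topCoeff a i))
    ((X : k⟦X⟧) ^ (l + 1)) (f i)
  refine ⟨r, ?_⟩
  ext1 i
  simp only [liftVal, jetLift_eq_add_topCoeff a, hr, Pi.add_apply, Pi.smul_apply, smul_eq_mul,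
    Matrix.mulVec, dotProduct, liftJac, Matrix.of_apply]
  ring

variable {e : ℕ → ℕ} {n : ℕ}

/-- The largest invariant `e m` is an exponent of `X` that annihilates the cokernel of `A`. -/
theorem HasInvariants.X_pow_smul_mem_range {A : Matrix (Fin m) (Fin N) k⟦X⟧}
    (hA : HasInvariants n e A) (hmono : ∀ i j, 1 ≤ i → i ≤ j → j ≤ m → e i ≤ e j)
    (hen : e m ≤ n) (y : Fin m → k⟦X⟧) :
    (X : k⟦X⟧) ^ e m • y ∈ LinearMap.range A.mulVecLin := by
  apply JetFib.X_pow_smul_mem_range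
  rw [hA _ (by omega), hA _ (by omega), Fintype.card_fin, expectedRank, expectedRank]
  have : ∑ j ∈ Finset.Icc 1 m, (e m + 1 - e j) = ∑ j ∈ Finset.Icc 1 m, ((e m - e j) + 1) := by
    refine Finset.sum_congr rfl fun j hj => ?_
    have hj := Finset.mem_Icc.mp hj
    have := hmono j m hj.1 hj.2 le_rfl
    omega
  rw [this, Finset.sum_add_distrib]
  simp

theorem HasInvariants.of_congr {A B D : Matrix (Fin m) (Fin N) k⟦X⟧}
    (hA : HasInvariants n e A) (hmono : ∀ i j, 1 ≤ i → i ≤ j → j ≤ m → e i ≤ e j)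
    (hen : e m ≤ n) (hB : B = A + (X : k⟦X⟧) ^ (e m + 1) • D) : HasInvariants n e B := by
  have h := range_mulVecLin_eq_of_congr hB (hA.X_pow_smul_mem_range hmono hen)
  intro i hi
  rw [← hA i hi, Matrix.rank, Matrix.rank, range_toeplitz, range_toeplitz, h]

/-- The image of the `n`-jets with invariants `e 1, …, e m` in the `l`-jets, in terms of linear
conditions: `f(θ) ∈ X ^ (l + 1) L + X ^ (n + 1) k⟦X⟧ ^ m`, where `L` is the column space of the
Jacobian matrix in the truncation of `θ` to order `e m`. -/
def truncModel (f : Fin m → MvPolynomial (Fin N) k) (n : ℕ) (e : ℕ → ℕ) (l : ℕ) :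
    Set (AffineJet k N l) :=
  {a | HasInvariants n e (liftJac f (trunc (e m) a)) ∧
    ∃ (w : Fin N → k⟦X⟧) (z : Fin m → k⟦X⟧), liftVal f a =
      ((X : k⟦X⟧) ^ (l + 1) • liftJac f (trunc (e m) a)).mulVec w + (X : k⟦X⟧) ^ (n + 1) • z}

/-- The condition on an `(l + 1)`-jet to be in the model is affine linear in its last
coefficients. -/
theorem mem_truncModel_succ_iff (f : Fin m → MvPolynomial (Fin N) k)
    (hmono : ∀ i j, 1 ≤ i → i ≤ j → j ≤ m → e i ≤ e j) (hen : e m ≤ n) {l : ℕ} (hl : e m ≤ l)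
    (a : AffineJet k N (l + 1)) :
    a ∈ truncModel f n e (l + 1) ↔ HasInvariants n e (liftJac f (trunc (e m) a)) ∧
      ∃ (w : Fin N → k⟦X⟧) (z : Fin m → k⟦X⟧), liftVal f (trunc l a) +
        ((X : k⟦X⟧) ^ (l + 1) • liftJac f (trunc (e m) a)).mulVec (fun i => C (topCoeff a i)) =
        ((X : k⟦X⟧) ^ (l + 2) • liftJac f (trunc (e m) a)).mulVec w + (X : k⟦X⟧) ^ (n + 1) • z := by
  refine and_congr_right fun hinv => ?_
  obtain ⟨r, hr⟩ := exists_liftVal_eq_add f a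
  obtain ⟨D, hD⟩ := exists_liftJac_eq_add f (l := e m) (trunc l a)
  rw [trunc_trunc hl] at hD
  obtain ⟨w₀, hw₀⟩ := hinv.X_pow_smul_mem_range hmono hen
    (D.mulVec (fun i => C (topCoeff a i)) + (X : k⟦X⟧) ^ (l - e m) • r)
  have key : liftVal f a = liftVal f (trunc l a) +
      ((X : k⟦X⟧) ^ (l + 1) • liftJac f (trunc (e m) a)).mulVec (fun i => C (topCoeff a i)) +
      ((X : k⟦X⟧) ^ (l + 2) • liftJac f (trunc (e m) a)).mulVec w₀ := by
    rw [Matrix.mulVecLin_apply] at hw₀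
    have hpow : (X : k⟦X⟧) ^ (2 * (l + 1)) = X ^ (l + 2) * X ^ e m * X ^ (l - e m) := by
      rw [← pow_add, ← pow_add]
      congr 1
      omega
    rw [hr, hD, Matrix.smul_mulVec, Matrix.smul_mulVec, hw₀, Matrix.add_mulVec, Matrix.smul_mulVec,
      hpow]
    ext1 i
    simp only [Pi.add_apply, Pi.smul_apply, smul_eq_mul]
    ring
  rw [key]
  constructor
  · rintro ⟨w, z, h⟩
    refine ⟨w - w₀, z, ?_⟩
    rw [Matrix.mulVec_sub, sub_add_eq_add_sub, ← h]
    abel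
  · rintro ⟨w, z, h⟩
    refine ⟨w + w₀, z, ?_⟩
    rw [h, Matrix.mulVec_add]
    abel

theorem trunc_mem_truncModel (f : Fin m → MvPolynomial (Fin N) k)
    (hmono : ∀ i j, 1 ≤ i → i ≤ j → j ≤ m → e i ≤ e j) (hen : e m ≤ n) {l : ℕ} (hl : e m ≤ l)
    {a : AffineJet k N (l + 1)} (ha : a ∈ truncModel f n e (l + 1)) :
    trunc l a ∈ truncModel f n e l := by
  obtain ⟨hinv, w, z, h⟩ := (mem_truncModel_succ_iff f hmono hen hl a).mp ha
  refine ⟨by rwa [trunc_trunc hl], (X : k⟦X⟧) • w - (fun i => C (topCoeff a i)), z, ?_⟩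
  rw [trunc_trunc hl, Matrix.mulVec_sub, sub_add_eq_add_sub, eq_sub_iff_add_eq, h,
    Matrix.smul_mulVec, Matrix.smul_mulVec, Matrix.mulVec_smul, smul_smul, ← pow_succ]

/-- Hensel's step: a jet of the model lifts to a jet of the model of the next order. If
`f(θ) = X ^ (l + 1) J w` modulo `X ^ (n + 1)`, the new coefficients are the constant terms of
`-w`. -/
theorem exists_mem_truncModel_succ (f : Fin m → MvPolynomial (Fin N) k)
    (hmono : ∀ i j, 1 ≤ i → i ≤ j → j ≤ m → e i ≤ e j) (hen : e m ≤ n) {l : ℕ} (hl : e m ≤ l)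
    {a : AffineJet k N l} (ha : a ∈ truncModel f n e l) :
    ∃ v, jetSnoc a v ∈ truncModel f n e (l + 1) := by
  obtain ⟨hinv, w, z, h⟩ := ha
  refine ⟨fun i => -constantCoeff (w i), ?_⟩
  have ht : ∀ v, trunc (e m) (jetSnoc a v) = trunc (e m) a := by
    intro v
    rw [← trunc_trunc hl, trunc_jetSnoc]
  rw [mem_truncModel_succ_iff f hmono hen hl, trunc_jetSnoc, topCoeff_jetSnoc, ht]
  have hw : ∀ i, ∃ w', w i = X * w' + C (constantCoeff (w i)) := by
    intro i
    obtain ⟨w', hw'⟩ := X_dvd_iff.mpr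
      (show constantCoeff (w i - C (constantCoeff (w i))) = 0 by simp)
    exact ⟨w', by rw [← hw']; ring⟩
  choose w' hw' using hw
  refine ⟨hinv, w', z, ?_⟩
  have hweq : w = (X : k⟦X⟧) • w' - fun i => C (-constantCoeff (w i)) := by
    ext1 i
    simp only [Pi.sub_apply, Pi.smul_apply, smul_eq_mul, map_neg, sub_neg_eq_add]
    exact hw' i
  rw [h]
  nth_rewrite 1 [hweq]
  rw [Matrix.mulVec_sub, Matrix.mulVec_smul, Matrix.smul_mulVec, Matrix.smul_mulVec,
    Matrix.smul_mulVec, smul_smul, ← pow_succ']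
  abel

/-- In the top order `n`, the model is the stratum itself, since `X ^ (n + 1) L` is zero modulo
`X ^ (n + 1)`. -/
theorem jetStratum_eq_truncModel (hmN : m ≤ N) (f : Fin m → MvPolynomial (Fin N) k)
    (hmono : ∀ i j, 1 ≤ i → i ≤ j → j ≤ m → e i ≤ e j) (hen : e m ≤ n) :
    jetStratum (Ideal.span (Set.range f)) f n m e = truncModel f n e n := by
  ext a
  rw [mem_jetStratum_iff hmN f _ hmono
    (fun i h1 h2 => (hmono i m h1 h2 le_rfl).trans hen), mem_jets_iff]
  obtain ⟨D, hD⟩ := exists_liftJac_eq_add f (l := e m) a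
  constructor
  · rintro ⟨⟨z, hz⟩, hinv⟩
    refine ⟨hinv.of_congr hmono hen (D := -D) (by rw [hD, smul_neg]; abel), 0, z, ?_⟩
    rw [hz, Matrix.mulVec_zero, zero_add]
  · rintro ⟨hinv, w, z, h⟩
    refine ⟨⟨(liftJac f (trunc (e m) a)).mulVec w + z, ?_⟩, hinv.of_congr hmono hen hD⟩
    rw [h, Matrix.smul_mulVec, smul_add]

/-- Jets of the model lift step by step up to order `n`, so the model is the image of the
stratum. -/
theorem truncStratum_eq_truncModel (hmN : m ≤ N) (f : Fin m → MvPolynomial (Fin N) k)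
    (hmono : ∀ i j, 1 ≤ i → i ≤ j → j ≤ m → e i ≤ e j) (hen : e m ≤ n) {l : ℕ} (hl : e m ≤ l)
    (hln : l ≤ n) :
    truncStratum (Ideal.span (Set.range f)) f n m e l = truncModel f n e l := by
  have hself : truncStratum (Ideal.span (Set.range f)) f n m e n = truncModel f n e n := by
    rw [truncStratum, jetStratum_eq_truncModel hmN f hmono hen]
    simp [trunc_self]
  revert hl
  induction hln using Nat.decreasingInduction with
  | self => exact fun _ => hself
  | of_succ l hln ih =>
    intro hl
    have ih := ih (by omega)
    have himg : truncStratum (Ideal.span (Set.range f)) f n m e l =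
        trunc l '' truncStratum (Ideal.span (Set.range f)) f n m e (l + 1) := by
      rw [truncStratum, truncStratum, Set.image_image]
      simp [trunc_trunc]
    rw [himg, ih]
    ext a
    constructor
    · rintro ⟨b, hb, rfl⟩
      exact trunc_mem_truncModel f hmono hen hl hb
    · intro ha
      obtain ⟨v, hv⟩ := exists_mem_truncModel_succ f hmono hen hl ha
      exact ⟨_, hv, trunc_jetSnoc a v⟩

end Model

/-! ### The images of the strata are locally closed -/

section LocallyClosed

open PowerSeries Module

variable {k : Type*} [Field k] {N m : ℕ}

/-- A system of linear equations is solvable if and only if the augmented matrix has the same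
rank. -/
theorem rank_fromCols_le_iff {ι κ : Type*} [Finite ι] [Fintype κ] (A : Matrix ι κ k) (v : ι → k) :
    (Matrix.fromCols A (Matrix.of fun i (_ : Unit) => v i)).rank ≤ A.rank ↔
      ∃ w, A.mulVec w = v := by
  have hle : LinearMap.range A.mulVecLin ≤
      LinearMap.range (Matrix.fromCols A (Matrix.of fun i (_ : Unit) => v i)).mulVecLin := by
    rintro _ ⟨w, rfl⟩
    refine ⟨Sum.elim w 0, ?_⟩
    rw [Matrix.mulVecLin_apply, Matrix.fromCols_mulVec]
    simp
  constructor
  · intro h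
    have : v ∈ LinearMap.range A.mulVecLin := by
      rw [Submodule.eq_of_le_of_finrank_le hle h]
      refine ⟨Sum.elim 0 1, ?_⟩
      rw [Matrix.mulVecLin_apply, Matrix.fromCols_mulVec]
      ext i
      simp [Matrix.mulVec, dotProduct]
    exact this
  · rintro ⟨w, rfl⟩
    refine Submodule.finrank_mono ?_
    rintro _ ⟨x, rfl⟩
    refine ⟨x ∘ Sum.inl + x (Sum.inr ()) • w, ?_⟩
    rw [Matrix.mulVecLin_apply, Matrix.mulVecLin_apply, Matrix.fromCols_mulVec, Matrix.mulVec_add,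
      Matrix.mulVec_smul]
    congr 1
    ext i
    simp [Matrix.mulVec, dotProduct, mul_comm]

theorem isOpen_le_rank {ι κ μ : Type*} [Finite ι] [Fintype κ]
    (M : Matrix ι κ (MvPolynomial μ k)) (r : ℕ) :
    @IsOpen _ (zariski k μ) {x | r ≤ (M.map (MvPolynomial.eval x)).rank} := by
  let _ := zariski k μ
  rcases r with _ | r
  · simp
  · rw [← isClosed_compl_iff]
    convert isClosed_rank_le M r using 1
    ext x
    simp

/-- The truncation to order `r` of the generic `l`-jet. -/
def genericTrunc (k : Type*) [Field k] (N l r : ℕ) :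
    Fin N × Fin (r + 1) → MvPolynomial (Fin N × Fin (l + 1)) k :=
  fun ij => if h : (ij.2 : ℕ) < l + 1 then MvPolynomial.X (ij.1, ⟨ij.2, h⟩) else 0

theorem eval_genericTrunc {l : ℕ} (r : ℕ) (a : AffineJet k N l) :
    (fun ij => MvPolynomial.eval a (genericTrunc k N l r ij)) = trunc r a := by
  ext ij
  simp only [genericTrunc, trunc]
  split_ifs <;> simp

theorem map_eval_X_pow_smul_liftJac (f : Fin m → MvPolynomial (Fin N) k) {σ : Type*} {l : ℕ}
    (a : σ → k) (b : Fin N × Fin (l + 1) → MvPolynomial σ k) (c : ℕ) :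
    ((X : (MvPolynomial σ k)⟦X⟧) ^ c • liftJac f b).map (PowerSeries.map (MvPolynomial.eval a)) =
      (X : k⟦X⟧) ^ c • liftJac f fun ij => MvPolynomial.eval a (b ij) := by
  rw [← map_eval_liftJac]
  ext1 i j
  simp

theorem HasInvariants.rank_toeplitz_X_pow_smul {n : ℕ} {e : ℕ → ℕ}
    {A : Matrix (Fin m) (Fin N) k⟦X⟧} (hA : HasInvariants n e A) {c : ℕ} (hc : c ≤ n + 1) :
    (toeplitz (n + 1) ((X : k⟦X⟧) ^ c • A)).rank = expectedRank m e (n + 1 - c) := by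
  obtain ⟨d, hd⟩ := Nat.exists_eq_add_of_le' hc
  rw [hd, JetFib.rank_toeplitz_X_pow_smul, Nat.add_sub_cancel]
  exact hA d (by omega)

/-- The model is given by equalities of ranks of truncations, and by the solvability of a linear
system, which bounds the rank of the augmented matrix `M`. -/
theorem isLocClosed_truncModel (f : Fin m → MvPolynomial (Fin N) k) {n : ℕ} {e : ℕ → ℕ} {l : ℕ}
    (hl : l ≤ n) : IsLocClosed (truncModel f n e l) := by
  let _ : TopologicalSpace (AffineJet k N l) := zariski k _
  let J := liftJac f (genericTrunc k N l (e m))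
  let M : Matrix (Fin m × Fin (n + 1)) ((Fin N × Fin (n + 1)) ⊕ Unit)
      (MvPolynomial (Fin N × Fin (l + 1)) k) :=
    Matrix.fromCols
      (toeplitz (n + 1) ((X : (MvPolynomial (Fin N × Fin (l + 1)) k)⟦X⟧) ^ (l + 1) • J))
      (Matrix.of fun i _ => jetCoeffs _ _ (n + 1) (liftVal f MvPolynomial.X) i)
  have hJ : ∀ (a : AffineJet k N l) i, (toeplitz i J).map (MvPolynomial.eval a) =
      toeplitz i (liftJac f (trunc (e m) a)) := by
    intro a i
    rw [map_toeplitz, map_eval_liftJac, eval_genericTrunc]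
  have hM : ∀ a : AffineJet k N l, M.map (MvPolynomial.eval a) = Matrix.fromCols
      (toeplitz (n + 1) ((X : k⟦X⟧) ^ (l + 1) • liftJac f (trunc (e m) a)))
      (Matrix.of fun i _ => jetCoeffs k _ (n + 1) (liftVal f a) i) := by
    intro a
    rw [← eval_genericTrunc, ← map_eval_X_pow_smul_liftJac, ← map_toeplitz]
    ext i (j | j)
    · rfl
    · change MvPolynomial.eval a (coeff _ (liftVal f MvPolynomial.X i.1)) =
        coeff _ (liftVal f a i.1)
      rw [← coeff_map, map_eval_liftVal]
      simp
  refine ⟨⋂ i ∈ Finset.range (n + 2),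
      {a | expectedRank m e i ≤ ((toeplitz i J).map (MvPolynomial.eval a)).rank},
    (⋂ i ∈ Finset.range (n + 2),
      {a | ((toeplitz i J).map (MvPolynomial.eval a)).rank ≤ expectedRank m e i}) ∩
      {a | (M.map (MvPolynomial.eval a)).rank ≤ expectedRank m e (n + 1 - (l + 1))},
    isOpen_biInter_finset fun i _ => isOpen_le_rank _ _,
    (isClosed_biInter fun i _ => isClosed_rank_le _ _).inter (isClosed_rank_le _ _), ?_⟩
  ext a
  have hinv : HasInvariants n e (liftJac f (trunc (e m) a)) ↔
      (∀ i ∈ Finset.range (n + 2),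
        expectedRank m e i ≤ (toeplitz i (liftJac f (trunc (e m) a))).rank) ∧
      (∀ i ∈ Finset.range (n + 2),
        (toeplitz i (liftJac f (trunc (e m) a))).rank ≤ expectedRank m e i) := by
    constructor
    · intro h
      exact ⟨fun i hi => (h i (by simpa [Nat.lt_succ_iff] using hi)).ge,
        fun i hi => (h i (by simpa [Nat.lt_succ_iff] using hi)).le⟩
    · intro h i hi
      have hi' : i ∈ Finset.range (n + 2) := Finset.mem_range.mpr (by omega)
      exact le_antisymm (h.2 i hi') (h.1 i hi')
  simp only [Set.mem_inter_iff, Set.mem_iInter, Set.mem_ofPred_eq, hJ, hM]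
  rw [← and_assoc, ← hinv]
  refine and_congr_right fun h => ?_
  rw [← h.rank_toeplitz_X_pow_smul (by omega), rank_fromCols_le_iff, exists_toeplitz_mulVec_eq_iff]

end LocallyClosed

/-! ### Trivialisation of the truncation maps -/

section Fibration

open PowerSeries Module

variable {k : Type*} [Field k] {N m : ℕ}

theorem toeplitz_submatrix_zero_mulVec {ι κ : Type*} [Fintype κ] (q : ℕ)
    (A : Matrix ι κ k⟦X⟧) (v : κ → k) :
    ((toeplitz (q + 1) A).submatrix id fun j => (j, 0)).mulVec v =
      jetCoeffs k ι (q + 1) (A.mulVec fun j => C (v j)) := by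
  rw [← toeplitz_mulVec_jetCoeffs]
  ext i
  simp only [Matrix.mulVec, dotProduct, Fintype.sum_prod_type, Matrix.submatrix_apply, id]
  refine Finset.sum_congr rfl fun j _ => ?_
  rw [Finset.sum_eq_single 0]
  · simp
  · intro d _ hd
    have : (d : ℕ) ≠ 0 := fun h => hd (Fin.ext h)
    simp [coeff_C, this]
  · simp

/-- Modulo the column space of `X ^ (c + 1) A`, that of `X ^ c A` is generated over `k` by the
columns of `X ^ c A`. -/
theorem rank_mul_submatrix_add {ι κ : Type*} [Fintype ι] [Fintype κ] {q : ℕ}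
    (A : Matrix ι κ k⟦X⟧) (c : ℕ) (K : Matrix (ι × Fin (q + 1)) (ι × Fin (q + 1)) k)
    (hK : ∀ y, K.mulVec y = 0 ↔ ∃ w, (toeplitz (q + 1) ((X : k⟦X⟧) ^ (c + 1) • A)).mulVec w = y) :
    (K * (toeplitz (q + 1) ((X : k⟦X⟧) ^ c • A)).submatrix id fun j => (j, 0)).rank +
      (toeplitz (q + 1) ((X : k⟦X⟧) ^ (c + 1) • A)).rank =
      (toeplitz (q + 1) ((X : k⟦X⟧) ^ c • A)).rank := by
  have hker : LinearMap.ker K.mulVecLin =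
      LinearMap.range (toeplitz (q + 1) ((X : k⟦X⟧) ^ (c + 1) • A)).mulVecLin := by
    ext y
    exact hK y
  have hle : LinearMap.range (toeplitz (q + 1) ((X : k⟦X⟧) ^ (c + 1) • A)).mulVecLin ≤
      LinearMap.range (toeplitz (q + 1) ((X : k⟦X⟧) ^ c • A)).mulVecLin := by
    rw [range_toeplitz, range_toeplitz]
    apply Submodule.map_mono
    rintro _ ⟨w, rfl⟩
    refine ⟨(X : k⟦X⟧) • w, ?_⟩
    rw [Matrix.mulVecLin_apply, Matrix.mulVecLin_apply, Matrix.smul_mulVec, Matrix.smul_mulVec,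
      Matrix.mulVec_smul, smul_smul, ← pow_succ]
  have hrange : LinearMap.range
      (K * (toeplitz (q + 1) ((X : k⟦X⟧) ^ c • A)).submatrix id fun j => (j, 0)).mulVecLin =
      (LinearMap.range (toeplitz (q + 1) ((X : k⟦X⟧) ^ c • A)).mulVecLin).map K.mulVecLin := by
    ext y
    constructor
    · rintro ⟨v, rfl⟩
      refine ⟨_, ⟨jetCoeffs k κ (q + 1) fun j => C (v j), rfl⟩, ?_⟩
      rw [Matrix.mulVecLin_apply, Matrix.mulVecLin_apply, Matrix.mulVecLin_apply,
        ← Matrix.mulVec_mulVec, toeplitz_submatrix_zero_mulVec, toeplitz_mulVec_jetCoeffs]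
    · rintro ⟨_, ⟨v, rfl⟩, rfl⟩
      obtain ⟨w, rfl⟩ := jetCoeffs_surjective (q + 1) v
      have hw : ∀ i, ∃ w', w i = C (constantCoeff (w i)) + X * w' := by
        intro i
        obtain ⟨w', hw'⟩ := X_dvd_iff.mpr
          (show constantCoeff (w i - C (constantCoeff (w i))) = 0 by simp)
        exact ⟨w', by rw [← hw']; ring⟩
      choose w' hw' using hw
      have hweq : w = (fun i => C (constantCoeff (w i))) + (X : k⟦X⟧) • w' := funext hw'
      refine ⟨fun j => constantCoeff (w j), ?_⟩
      rw [Matrix.mulVecLin_apply, Matrix.mulVecLin_apply, Matrix.mulVecLin_apply,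
        ← Matrix.mulVec_mulVec, toeplitz_submatrix_zero_mulVec, toeplitz_mulVec_jetCoeffs]
      nth_rewrite 2 [hweq]
      rw [Matrix.mulVec_add, map_add, Matrix.mulVec_add, left_eq_add, hK]
      refine ⟨jetCoeffs k κ (q + 1) w', ?_⟩
      rw [toeplitz_mulVec_jetCoeffs, Matrix.smul_mulVec, Matrix.smul_mulVec, Matrix.mulVec_smul,
        smul_smul, ← pow_succ]
  have h := finrank_map_add_finrank_inf_ker K.mulVecLin
    (LinearMap.range (toeplitz (q + 1) ((X : k⟦X⟧) ^ c • A)).mulVecLin)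
  rw [hker, inf_eq_right.mpr hle, ← hrange] at h
  exact h

/-- The coordinates of an `(l + 1)`-jet are those of its truncation and the last coefficients. -/
def jetSuccEquiv (N l : ℕ) : (Fin N × Fin (l + 1)) ⊕ Fin N ≃ Fin N × Fin (l + 1 + 1) :=
  Equiv.ofBijective
    (Sum.elim (fun ij => (ij.1, ij.2.castSucc)) fun i => (i, Fin.last (l + 1))) <| by
    constructor
    · rintro (⟨i, j⟩ | i) (⟨i', j'⟩ | i') h
      · simpa using h
      · have := (Prod.ext_iff.mp h).2
        exact absurd this (Fin.castSucc_lt_last j).ne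
      · have := (Prod.ext_iff.mp h).2
        exact absurd this.symm (Fin.castSucc_lt_last j').ne
      · simpa using h
    · rintro ⟨i, j⟩
      induction j using Fin.lastCases with
      | last => exact ⟨Sum.inr i, rfl⟩
      | cast j => exact ⟨Sum.inl (i, j), rfl⟩

theorem isRegularFun_eval_trunc {l : ℕ} (r : ℕ) (S : Set (AffineJet k N l))
    (p : MvPolynomial (Fin N × Fin (r + 1)) k) :
    IsRegularFun S (fun x => MvPolynomial.eval (trunc r x) p) := by
  refine IsRegularFun.eval_comp (Φ := trunc r) (fun ij => ?_) p
  simp only [← eval_genericTrunc]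
  exact isRegularFun_eval S _

variable {n : ℕ} {e : ℕ → ℕ}

/-- Near a jet `γ` of order `e m` in the image of the stratum, the truncation maps between the
images of the stratum in consecutive orders are trivial fibrations. -/
theorem exists_isTrivialFibration_succ (f : Fin m → MvPolynomial (Fin N) k)
    (hmono : ∀ i j, 1 ≤ i → i ≤ j → j ≤ m → e i ≤ e j) {l : ℕ} (hl : e m ≤ l)
    (hln : l < n) {γ : AffineJet k N (e m)} (hγ : HasInvariants n e (liftJac f γ)) :
    ∃ h : MvPolynomial (Fin N × Fin (e m + 1)) k, MvPolynomial.eval γ h ≠ 0 ∧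
      ∀ U : Set (AffineJet k N (e m)), (∀ x ∈ U, MvPolynomial.eval x h ≠ 0) →
        IsTrivialFibration (trunc l) (truncModel f n e (l + 1) ∩ trunc (e m) ⁻¹' U)
          (truncModel f n e l ∩ trunc (e m) ⁻¹' U)
          (N - (expectedRank m e (n - l) - expectedRank m e (n - l - 1))) := by
  have hen : e m ≤ n := by omega
  let T : ℕ → Matrix (Fin m × Fin (n + 1)) (Fin N × Fin (n + 1))
      (MvPolynomial (Fin N × Fin (e m + 1)) k) := fun c => toeplitz (n + 1)
    ((X : (MvPolynomial (Fin N × Fin (e m + 1)) k)⟦X⟧) ^ c • liftJac f MvPolynomial.X)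
  have hT : ∀ c (x : AffineJet k N (e m)), (T c).map (MvPolynomial.eval x) =
      toeplitz (n + 1) ((X : k⟦X⟧) ^ c • liftJac f x) := by
    intro c x
    rw [map_toeplitz, map_eval_X_pow_smul_liftJac]
    simp
  have hrk : ∀ x : AffineJet k N (e m), HasInvariants n e (liftJac f x) →
      (toeplitz (n + 1) ((X : k⟦X⟧) ^ (l + 2) • liftJac f x)).rank =
        expectedRank m e (n - l - 1) := by
    intro x hx
    rw [hx.rank_toeplitz_X_pow_smul (by omega)]
    congr 1
    omega
  have hrk' : ∀ x : AffineJet k N (e m), HasInvariants n e (liftJac f x) →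
      (toeplitz (n + 1) ((X : k⟦X⟧) ^ (l + 1) • liftJac f x)).rank =
        expectedRank m e (n - l) := by
    intro x hx
    rw [hx.rank_toeplitz_X_pow_smul (by omega)]
    congr 1
    omega
  -- the first minor: `K` has kernel `X ^ (l + 2) L` modulo `X ^ (n + 1)`
  obtain ⟨s, u, hsu⟩ := exists_submatrix_det_ne_zero _ (hrk γ hγ).ge
  let K := leftKer (T (l + 2)) s u
  have hK : ∀ x : AffineJet k N (e m), HasInvariants n e (liftJac f x) →
      MvPolynomial.eval x ((T (l + 2)).submatrix s u).det ≠ 0 → ∀ y,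
      (K.map (MvPolynomial.eval x)).mulVec y = 0 ↔
        ∃ w, (toeplitz (n + 1) ((X : k⟦X⟧) ^ (l + 2) • liftJac f x)).mulVec w = y := by
    intro x hx hdet y
    rw [map_leftKer, hT]
    refine leftKer_mulVec_eq_zero_iff _ (hrk x hx).le ?_ y
    rwa [RingHom.map_det, RingHom.mapMatrix_apply, ← Matrix.submatrix_map, hT] at hdet
  -- the columns with index `(j, 0)` express `X ^ (l + 1) J v` for a constant vector `v`
  let A := K * (T (l + 1)).submatrix id fun j => (j, 0)
  have hA : ∀ x : AffineJet k N (e m), A.map (MvPolynomial.eval x) =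
      K.map (MvPolynomial.eval x) *
        (toeplitz (n + 1) ((X : k⟦X⟧) ^ (l + 1) • liftJac f x)).submatrix id fun j => (j, 0) := by
    intro x
    rw [← hT, Matrix.map_mul]
    rfl
  have hArank : ∀ x : AffineJet k N (e m), HasInvariants n e (liftJac f x) →
      MvPolynomial.eval x ((T (l + 2)).submatrix s u).det ≠ 0 →
      (A.map (MvPolynomial.eval x)).rank =
        expectedRank m e (n - l) - expectedRank m e (n - l - 1) := by
    intro x hx hdet
    have := rank_mul_submatrix_add (liftJac f x) (l + 1) _ (hK x hx hdet)
    rw [hrk' x hx, hrk x hx, ← hA] at this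
    omega
  have hγdet : MvPolynomial.eval γ ((T (l + 2)).submatrix s u).det ≠ 0 := by
    rwa [RingHom.map_det, RingHom.mapMatrix_apply, ← Matrix.submatrix_map, hT]
  -- the second minor solves the system `A v = -K f(θ)` of the fibre
  obtain ⟨s', u', hsu'⟩ := exists_submatrix_det_ne_zero _ (hArank γ hγ hγdet).ge
  have hu' : Function.Injective u' := by
    intro i j hij
    by_contra hne
    exact hsu' (Matrix.det_zero_of_column_eq hne fun r => by simp [hij])
  refine ⟨((T (l + 2)).submatrix s u).det * (A.submatrix s' u').det, ?_, fun U hU => ?_⟩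
  · rw [map_mul]
    refine mul_ne_zero hγdet ?_
    rwa [RingHom.map_det, RingHom.mapMatrix_apply, ← Matrix.submatrix_map]
  have hU1 : ∀ x ∈ U, MvPolynomial.eval x ((T (l + 2)).submatrix s u).det ≠ 0 := by
    intro x hx
    have := hU x hx
    rw [map_mul] at this
    exact left_ne_zero_of_mul this
  have hU2 : ∀ x ∈ U, ((A.map (MvPolynomial.eval x)).submatrix s' u').det ≠ 0 := by
    intro x hx
    have := hU x hx
    rw [map_mul] at this
    have := right_ne_zero_of_mul this
    rwa [RingHom.map_det, RingHom.mapMatrix_apply, ← Matrix.submatrix_map] at this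
  have hE : ∀ x : AffineJet k N (l + 1), x ∈ truncModel f n e (l + 1) ∩ trunc (e m) ⁻¹' U ↔
      trunc l x ∈ truncModel f n e l ∩ trunc (e m) ⁻¹' U ∧
      (A.map (MvPolynomial.eval (trunc (e m) (trunc l x)))).mulVec
        (fun j => x (jetSuccEquiv N l (Sum.inr j))) =
      -(K.map (MvPolynomial.eval (trunc (e m) (trunc l x)))).mulVec
        (jetCoeffs k _ (n + 1) (liftVal f (trunc l x))) := by
    intro x
    have hlin : HasInvariants n e (liftJac f (trunc (e m) x)) → trunc (e m) x ∈ U →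
        (x ∈ truncModel f n e (l + 1) ↔
          (A.map (MvPolynomial.eval (trunc (e m) x))).mulVec (topCoeff x) =
            -(K.map (MvPolynomial.eval (trunc (e m) x))).mulVec
              (jetCoeffs k _ (n + 1) (liftVal f (trunc l x)))) := by
      intro hinv hxU
      rw [mem_truncModel_succ_iff f hmono hen hl, ← exists_toeplitz_mulVec_eq_iff,
        ← hK _ hinv (hU1 _ hxU), map_add, Matrix.mulVec_add, hA, ← Matrix.mulVec_mulVec,
        toeplitz_submatrix_zero_mulVec, ← add_eq_zero_iff_eq_neg']
      exact and_iff_right hinv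
    rw [trunc_trunc hl]
    constructor
    · rintro ⟨h1, h2⟩
      refine ⟨⟨trunc_mem_truncModel f hmono hen hl h1, ?_⟩, (hlin h1.1 h2).mp h1⟩
      rwa [Set.mem_preimage, trunc_trunc hl]
    · rintro ⟨⟨h1, h2⟩, h3⟩
      rw [Set.mem_preimage, trunc_trunc hl] at h2
      have hinv := h1.1
      rw [trunc_trunc hl] at hinv
      exact ⟨(hlin hinv h2).mpr h3, h2⟩
  refine isTrivialFibration_of_linear (jetSuccEquiv N l) (fun x i => ?_)
    (A := fun x => A.map (MvPolynomial.eval (trunc (e m) x)))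
    (b := fun x => -(K.map (MvPolynomial.eval (trunc (e m) x))).mulVec
        (jetCoeffs k _ (n + 1) (liftVal f x)))
    (fun i j => isRegularFun_eval_trunc _ _ _) (fun i => ?_) hE (fun x hx => ?_)
    (fun x hx => ?_) hu' (fun x hx => hU2 _ hx.2)
  · have := i.2.2
    exact dif_pos (by omega)
  · refine (IsRegularFun.sum _ fun j => ?_).neg
    refine (isRegularFun_eval_trunc _ _ _).mul ?_
    refine (isRegularFun_eval _ (coeff (j.2 : ℕ) (liftVal f MvPolynomial.X j.1))).congr
      fun x _ => ?_
    rw [← coeff_map, map_eval_liftVal]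
    simp
  · obtain ⟨v, hv⟩ := exists_mem_truncModel_succ f hmono hen hl hx.1
    have htr : trunc (e m) (jetSnoc x v) = trunc (e m) x := by
      rw [← trunc_trunc hl, trunc_jetSnoc]
    have h := ((hE (jetSnoc x v)).mp ⟨hv, by rw [Set.mem_preimage, htr]; exact hx.2⟩).2
    rw [trunc_jetSnoc] at h
    exact ⟨_, h⟩
  · exact (hArank _ hx.1.1 (hU1 _ hx.2)).le

/-- The open neighbourhood of `γ` in `exists_isTrivialFibration_succ` can be chosen independently of
the order `l`. -/
theorem exists_isTrivialFibration_trunc (f : Fin m → MvPolynomial (Fin N) k)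
    (hmono : ∀ i j, 1 ≤ i → i ≤ j → j ≤ m → e i ≤ e j)
    {γ : AffineJet k N (e m)} (hγ : HasInvariants n e (liftJac f γ)) :
    ∃ h : MvPolynomial (Fin N × Fin (e m + 1)) k, MvPolynomial.eval γ h ≠ 0 ∧
      ∀ U : Set (AffineJet k N (e m)), (∀ x ∈ U, MvPolynomial.eval x h ≠ 0) →
        ∀ l, e m ≤ l → l < n →
        IsTrivialFibration (trunc l) (truncModel f n e (l + 1) ∩ trunc (e m) ⁻¹' U)
          (truncModel f n e l ∩ trunc (e m) ⁻¹' U)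
          (N - (expectedRank m e (n - l) - expectedRank m e (n - l - 1))) := by
  choose! h h1 h2 using fun (l : ℕ) (hl : e m ≤ l ∧ l < n) =>
    exists_isTrivialFibration_succ f hmono hl.1 hl.2 hγ
  refine ⟨∏ l ∈ Finset.Ico (e m) n, h l, ?_, fun U hU l hl hln => h2 l ⟨hl, hln⟩ U fun x hx => ?_⟩
  · rw [map_prod, Finset.prod_ne_zero_iff]
    exact fun l hl => h1 l (Finset.mem_Ico.mp hl)
  · have := hU x hx
    rw [map_prod, Finset.prod_ne_zero_iff] at this
    exact this l (Finset.mem_Ico.mpr ⟨hl, hln⟩)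

theorem isTrivialFibration_trunc_of_succ {E : (l : ℕ) → Set (AffineJet k N l)} {d : ℕ → ℕ} {l₀ : ℕ}
    (h : ∀ l, l₀ ≤ l → l < n → IsTrivialFibration (trunc l) (E (l + 1)) (E l) (d l)) {l l' : ℕ}
    (hl : l₀ ≤ l) (hll' : l ≤ l') (hl' : l' ≤ n) :
    IsTrivialFibration (trunc l) (E l') (E l) (∑ j ∈ Finset.Ico l l', d j) := by
  induction l', hll' using Nat.le_induction with
  | base => simpa using isTrivialFibration_id trunc_self (E l)
  | succ l' hll' ih =>
    rw [Finset.sum_Ico_succ_top hll']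
    exact (h l' (by omega) (by omega)).comp (fun x => (trunc_trunc hll' x).symm) (ih (by omega))

end Fibration

/-! ### Dimensions of the fibres -/

section Dimension

theorem expectedRank_succ (m : ℕ) (e : ℕ → ℕ) (i : ℕ) : expectedRank m e (i + 1) =
    expectedRank m e i + ((Finset.Icc 1 m).filter fun j => e j ≤ i).card := by
  rw [expectedRank, expectedRank, Finset.card_filter, ← Finset.sum_add_distrib]
  refine Finset.sum_congr rfl fun j _ => ?_
  split_ifs <;> omega

/-- The number of equations for the fibre in terms of the index `a` of the last invariant less than
`i`. -/
theorem expectedRank_sub_eq_of_isGreatest {m : ℕ} {e : ℕ → ℕ}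
    (hmono : ∀ i j, 1 ≤ i → i ≤ j → j ≤ m → e i ≤ e j) {i a : ℕ} (hi : 0 < i)
    (ha : IsGreatest {j | j ≤ m ∧ e j < i} a) :
    expectedRank m e i - expectedRank m e (i - 1) = a := by
  obtain ⟨i, rfl⟩ := Nat.exists_eq_add_of_lt hi
  rw [zero_add, Nat.add_sub_cancel, expectedRank_succ, Nat.add_sub_cancel_left]
  have : ((Finset.Icc 1 m).filter fun j => e j ≤ i) = Finset.Icc 1 a := by
    ext j
    simp only [Finset.mem_filter, Finset.mem_Icc]
    have ham := ha.1.1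
    have hai := ha.1.2
    constructor
    · rintro ⟨⟨h1, h2⟩, h3⟩
      exact ⟨h1, ha.2 ⟨h2, by omega⟩⟩
    · rintro ⟨h1, h2⟩
      have := hmono j a h1 h2 ham
      exact ⟨⟨h1, by omega⟩, by omega⟩
  rw [this, Nat.card_Icc, Nat.add_sub_cancel]

/-- The differences of the expected ranks telescope. -/
theorem sum_fibreDim_add_expectedRank {N m n : ℕ} (hmN : m ≤ N) (e : ℕ → ℕ) {l : ℕ} (hl : l ≤ n) :
    ∑ j ∈ Finset.Ico l n, (N - (expectedRank m e (n - j) - expectedRank m e (n - j - 1))) +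
      expectedRank m e (n - l) = N * (n - l) := by
  induction hl using Nat.decreasingInduction with
  | self => simp [expectedRank]
  | of_succ l hl ih =>
    rw [Finset.sum_eq_sum_Ico_succ_bot hl]
    obtain ⟨d, hd⟩ : ∃ d, n - l = d + 1 := ⟨n - l - 1, by omega⟩
    have hd' : n - (l + 1) = d := by omega
    have hcard : ((Finset.Icc 1 m).filter fun j => e j ≤ d).card ≤ m :=
      (Finset.card_filter_le _ _).trans (by simp)
    rw [hd'] at ih
    rw [hd, Nat.add_sub_cancel, mul_add, mul_one, ← ih, expectedRank_succ]
    omega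

end Dimension

theorem isOpenIn_trunc_ne_zero {k : Type*} [Field k] {N l r : ℕ} (T : Set (AffineJet k N l))
    (h : MvPolynomial (Fin N × Fin (r + 1)) k) :
    IsOpenIn (T ∩ trunc r ⁻¹' {x | MvPolynomial.eval x h ≠ 0}) T := by
  refine ⟨_, isOpen_zariski_ne_zero (MvPolynomial.bind₁ (genericTrunc k N l r) h), ?_⟩
  ext x
  have : MvPolynomial.eval x (MvPolynomial.bind₁ (genericTrunc k N l r) h) =
      MvPolynomial.eval (trunc r x) h := by
    rw [← eval_genericTrunc]
    exact MvPolynomial.eval₂Hom_bind₁ (RingHom.id k) x _ h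
  simp [this]

end JetFib
end

open JetFib
theorem proposition2 {k : Type*} [Field k] [IsAlgClosed k] {N m : ℕ} (hmN : m ≤ N)
    (I : Ideal (MvPolynomial (Fin N) k)) (f : Fin m → MvPolynomial (Fin N) k)
    (hf : I = Ideal.span (Set.range f)) (n : ℕ) (e : ℕ → ℕ) (he0 : e 0 = 0)
    (hmono : ∀ i j, 1 ≤ i → i ≤ j → j ≤ m → e i ≤ e j)
    (heg : ∀ i, 1 ≤ i → i ≤ m → e i < halfUp n) :
    -- (a)
    (∀ l, e m ≤ l → l ≤ n → IsLocClosed (truncStratum I f n m e l)) ∧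
    -- (b)
    (∀ γ ∈ truncStratum I f n m e (e m), ∃ U : Set (AffineJet k N (e m)),
      IsOpenIn U (truncStratum I f n m e (e m)) ∧ γ ∈ U ∧
      ∀ l, e m ≤ l → l < n → ∀ a, IsGreatest {i | i ≤ m ∧ e i < n - l} a →
        IsTrivialFibration (trunc l)
          (truncStratum I f n m e (l + 1) ∩ trunc (e m) ⁻¹' U)
          (truncStratum I f n m e l ∩ trunc (e m) ⁻¹' U)
          (N - a)) ∧
    -- (c)
    (∀ l, e m ≤ l → l < n → ∃ s : ℕ,
      IsLocallyTrivialFibration (trunc l) (jetStratum I f n m e) (truncStratum I f n m e l) s ∧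
      (l + e m ≤ n → s = (N - m) * (n - l) + ∑ i ∈ Finset.Icc 1 m, e i) ∧
      (l = e m → m < N → ⌈((N : ℚ) - m + 1) * ((n : ℚ) / 2)⌉ ≤ (s : ℤ))) := by
  subst hf
  -- if `m = 0`, then `e m` is `e 0 = 0`
  have h2em : 2 * e m ≤ n := by
    rcases Nat.eq_zero_or_pos m with rfl | hm
    · simp [he0]
    · have := heg m hm le_rfl
      unfold halfUp at this
      split_ifs at this <;> omega
  have hen : e m ≤ n := by omega
  have hmodel : ∀ l, e m ≤ l → l ≤ n →
      truncStratum (Ideal.span (Set.range f)) f n m e l = truncModel f n e l :=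
    fun l hl hln => truncStratum_eq_truncModel hmN f hmono hen hl hln
  refine ⟨fun l hl hln => ?_, fun γ hγ => ?_, fun l hl hln => ?_⟩
  · rw [hmodel l hl hln]
    exact isLocClosed_truncModel f hln
  · rw [hmodel _ le_rfl hen] at hγ ⊢
    have hinv := hγ.1
    rw [trunc_self] at hinv
    obtain ⟨h, hγh, H⟩ := exists_isTrivialFibration_trunc f hmono hinv
    refine ⟨truncModel f n e (e m) ∩ trunc (e m) ⁻¹' {x | MvPolynomial.eval x h ≠ 0},
      isOpenIn_trunc_ne_zero _ h, ⟨hγ, by simpa [trunc_self] using hγh⟩, fun l hl hln a ha => ?_⟩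
    rw [hmodel _ (by omega) hln, hmodel l hl hln.le,
      ← expectedRank_sub_eq_of_isGreatest hmono (by omega) ha]
    refine H _ (fun x hx => ?_) l hl hln
    simpa [trunc_self] using hx.2
  · refine ⟨∑ j ∈ Finset.Ico l n, (N - (expectedRank m e (n - j) - expectedRank m e (n - j - 1))),
      ⟨?_, fun b hb => ?_⟩, ?_, ?_⟩
    · exact Set.mapsTo_image _ _
    · -- near `b`, the map is a composition of the trivial fibrations in consecutive orders
      rw [hmodel l hl hln.le] at hb ⊢
      obtain ⟨h, hγh, H⟩ := exists_isTrivialFibration_trunc f hmono hb.1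
      refine ⟨truncModel f n e l ∩ trunc (e m) ⁻¹' {x | MvPolynomial.eval x h ≠ 0},
        isOpenIn_trunc_ne_zero _ h, ⟨hb, hγh⟩, ?_⟩
      have key := isTrivialFibration_trunc_of_succ
        (E := fun l => truncModel f n e l ∩ trunc (e m) ⁻¹' {x | MvPolynomial.eval x h ≠ 0})
        (d := fun j => N - (expectedRank m e (n - j) - expectedRank m e (n - j - 1)))
        (H _ fun x hx => hx) hl hln.le le_rfl
      convert key using 1
      rw [jetStratum_eq_truncModel hmN f hmono hen]
      ext x
      simp only [Set.mem_inter_iff, Set.mem_preimage, trunc_trunc hl]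
      refine and_congr_right fun hx => and_iff_right ?_
      rw [← jetStratum_eq_truncModel hmN f hmono hen] at hx
      rw [← hmodel l hl hln.le]
      exact ⟨x, hx, rfl⟩
    all_goals
      have hsum := sum_fibreDim_add_expectedRank hmN e hln.le
      set s := ∑ j ∈ Finset.Ico l n,
        (N - (expectedRank m e (n - j) - expectedRank m e (n - j - 1)))
      have hdim : l + e m ≤ n → s = (N - m) * (n - l) + ∑ i ∈ Finset.Icc 1 m, e i := by
        intro hle
        have h1 : expectedRank m e (n - l) + ∑ i ∈ Finset.Icc 1 m, e i = m * (n - l) := by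
          rw [expectedRank, ← Finset.sum_add_distrib,
            Finset.sum_congr rfl (g := fun _ => n - l) fun j hj => ?_]
          · simp
          · have hj := Finset.mem_Icc.mp hj
            have := hmono j m hj.1 hj.2 le_rfl
            omega
        have h2 : N * (n - l) = (N - m) * (n - l) + m * (n - l) := by
          rw [← add_mul, Nat.sub_add_cancel hmN]
        omega
    · exact hdim
    · intro hlem hmN'
      have hs := hdim (by omega)
      have hem : e m ≤ ∑ i ∈ Finset.Icc 1 m, e i := by
        rcases Nat.eq_zero_or_pos m with rfl | hm
        · simp [he0]
        · exact Finset.single_le_sum (f := e) (fun _ _ => Nat.zero_le _)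
            (Finset.mem_Icc.mpr ⟨hm, le_rfl⟩)
      rw [Int.ceil_le, hs, hlem]
      push_cast [Nat.cast_sub hmN, Nat.cast_sub hen]
      have q1 : (e m : ℚ) ≤ ∑ i ∈ Finset.Icc 1 m, (e i : ℚ) := by exact_mod_cast hem
      have q2 : (m : ℚ) + 1 ≤ N := by exact_mod_cast hmN'
      have q3 : 2 * (e m : ℚ) ≤ n := by exact_mod_cast h2em
      nlinarith [mul_nonneg (sub_nonneg.mpr q2) (sub_nonneg.mpr q3)]
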